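/- Let $\Bbbk$ be a field and let $H$ be a Hopf algebra over $\Bbbk$ with comultiplication $\Delta(a)=a_1\otimes a_2$, counit $\varepsilon$ and antipode $S$. Let ${}_\varepsilon\Bbbk$ and $\Bbbk_\varepsilon$ be the trivial left and right $H$-modules, that is, $\Bbbk$ with $H$ acting through $\varepsilon$. Assume that ${}_\varepsilon\Bbbk$ has a (possibly infinite) resolution by finitely generated projective left $H$-modules, or that $\Bbbk_\varepsilon$ has one by finitely generated projective right $H$-modules. Consider the conditions (i) $\dim_\Bbbk \operatorname{Ext}^i_H({}_\varepsilon\Bbbk,H)=1$ for some integer $i\ge 0$; (ii) $\dim_\Bbbk \operatorname{Ext}^j_{H^{\mathrm{op}}}(\Bbbk_\varepsilon,H)=1$ for some integer $j\ge 0$. If (i) or (ii) holds, then $S$ is injective. Suppose that (i) and (ii) both hold with $i=j$, and moreover that every left invertible element of $H$ is regular (neither a left nor a right zero divisor), or that every right invertible element of $H$ is regular. Then $S$ is bijective. Moreover, there are algebra homomorphisms $\xi,\eta:H\to\Bbbk$ such that the right $H$-action on $\operatorname{Ext}^i_H({}_\varepsilon\Bbbk,H)$ induced by right multiplication on $H$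 is $x\cdot b=\xi(b)x$, the left $H$-action on $\operatorname{Ext}^i_{H^{\mathrm{op}}}(\Bbbk_\varepsilon,H)$ induced by left multiplication on $H$ is $b\cdot x=\eta(b)x$, and $S^4\circ\Xi^\ell_\xi\circ\Xi^r_\eta$ is an inner automorphism of $H$: there is an invertible $v\in H$ with $$S^4\bigl(\Xi^\ell_\xi(\Xi^r_\eta(a))\bigr)=v^{-1}av\qquad\text{for all } a\in H.$$ Here $\Xi^\ell_\xi(a)=\xi(a_1)a_2$ and $\Xi^r_\eta(a)=a_1\eta(a_2)$ are the left and right winding automorphisms. -/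

import Mathlib

universe u

namespace HopfExt

open CategoryTheory

section Resolutions

/-- `M` has a resolution `⋯ → P₁ → P₀ → M → 0` (possibly of infinite length) all of whose terms
are finitely generated projective modules. -/
def HasFGProjectiveResolution {A : Type u} [Ring A] (M : ModuleCat.{u} A) : Prop :=
  ∃ P : ProjectiveResolution M, ∀ n : ℕ, Module.Finite A (P.complex.X n)

end Resolutions

noncomputable section Hopf

variable (k H : Type u) [Field k] [Ring H] [HopfAlgebra k H]

/-- The trivial left module: `k` with `h • c = ε(h) c`. -/
def leftTrivial : ModuleCat.{u} H :=
  (ModuleCat.restrictScalars (Bialgebra.counitAlgHom k H).toRingHom).obj (ModuleCat.of k k)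

/-- The trivial right module: `k` with `c • h = c ε(h)`. Right `H`-modules are modules over
`Hᵐᵒᵖ`. -/
def rightTrivial : ModuleCat.{u} Hᵐᵒᵖ :=
  (ModuleCat.restrictScalars
    ((Bialgebra.counitAlgHom k H).toRingHom.fromOpposite fun _ _ => Commute.all _ _)).obj
      (ModuleCat.of k k)

/-- `Ext^i_H(εk, H)`, computed in the category of left `H`-modules. -/
abbrev LeftExt (i : ℕ) : Type u :=
  Abelian.Ext.{u} (leftTrivial k H) (ModuleCat.of H H) i

/-- `Ext^j_{H^op}(k_ε, H)`, computed in the category of right `H`-modules. -/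
abbrev RightExt (j : ℕ) : Type u :=
  Abelian.Ext.{u} (rightTrivial k H) (ModuleCat.of Hᵐᵒᵖ H) j

variable {k H}

/-- The right action of `b` on `Ext^i_H(εk, H)`, induced by the endomorphism `a ↦ a * b` of the
left `H`-module `H`. -/
def rightAct {i : ℕ} (x : LeftExt k H i) (b : H) : LeftExt k H i :=
  x.comp (Abelian.Ext.mk₀ (ModuleCat.ofHom
    (DistribSMul.toLinearMap H H (MulOpposite.op b)))) (add_zero i)

/-- The left action of `b` on `Ext^j_{H^op}(k_ε, H)`, induced by the endomorphism `a ↦ b * a` of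
the right `H`-module `H`. -/
def leftAct {j : ℕ} (b : H) (x : RightExt k H j) : RightExt k H j :=
  x.comp (Abelian.Ext.mk₀ (ModuleCat.ofHom
    (DistribSMul.toLinearMap Hᵐᵒᵖ H b))) (add_zero j)

/-- The left winding automorphism `a ↦ ξ(a₁) a₂` given by a character `ξ`. -/
def leftWinding (ξ : H →ₐ[k] k) : H →ₐ[k] H :=
  (Algebra.TensorProduct.lid k H).toAlgHom.comp
    ((Algebra.TensorProduct.map ξ (AlgHom.id k H)).comp (Bialgebra.comulAlgHom k H))

/-- The right winding automorphism `a ↦ a₁ ξ(a₂)` given by a character `ξ`. -/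
def rightWinding (ξ : H →ₐ[k] k) : H →ₐ[k] H :=
  (Algebra.TensorProduct.rid k k H).toAlgHom.comp
    ((Algebra.TensorProduct.map (AlgHom.id k H) ξ).comp (Bialgebra.comulAlgHom k H))

theorem leftWinding_apply (ξ : H →ₐ[k] k) {ι : Type*} {a : H} (r : Coalgebra.Repr k a ι) :
    leftWinding ξ a = ∑ i ∈ r.index, ξ (r.left i) • r.right i := by
  simp [leftWinding, ← r.eq]

theorem rightWinding_apply (ξ : H →ₐ[k] k) {ι : Type*} {a : H} (r : Coalgebra.Repr k a ι) :
    rightWinding ξ a = ∑ i ∈ r.index, ξ (r.right i) • r.left i := by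
  simp [rightWinding, ← r.eq]

end Hopf

end HopfExt

/-!
Write `A = H ⊗ Hᵐᵒᵖ`, so that `A`-modules are `H`-bimodules, and write `¹H^σ` and `^τH¹` for the
bimodule `H` with the right action twisted by `σ`, respectively the left action twisted by `τ`. The
idea is to compute the right `A`-module `Ext_A^n(H, A)` in two ways and to compare the results.

Let `H` embed into `A` by `h ↦ h₁ ⊗ S(h₂)` (`leftEmb`). The bimodule `H` is induced along this map
from the trivial left module, since a vector of a bimodule is central exactly if it is invariant
under the adjoint action (`leftUnit_bijective`), and `A` is free over `H` on both sides. Dimension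
shifting, with modules coextended from the field, gives `Ext_A^n(H, M) ≃ Ext_H^n(εk, M)` for all
bimodules `M` (`resExt_bijective`). In the same way `op h ↦ S(h₁) ⊗ h₂` (`rightEmb`) gives
`Ext_A^n(H, M) ≃ Ext_{H^op}^n(k_ε, M)`. Neither isomorphism needs `S` to be bijective: the
factorizations of `A` are twists by `S` or by `op ∘ S`, which have the convolution inverses `id`
and `op ∘ S²`.

The two isomorphisms together express `Ext` on one side through `Ext` on the other, so finiteness
passes from one side to the other (`IsFinitaryExt.transfer`): a class with coefficients in a free
module is determined by finitely many of its coordinates. Given this,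
`Ext_H^n(εk, A) = Ext_H^n(εk, H) ⊗ H`, where the second factor comes from a complement `1 ⊗ H` of
the embedding. If `Ext_H^n(εk, H)` is one-dimensional, `H` acts on it by a character `ξ`, and it
follows from `rightFactor_mul_tmul` that `Ext_A^n(H, A)` is `¹H^σ` with `σ = S² Ξˡ_ξ`
(`orbitExt_rightFactor_mul`). Symmetrically, it is `^τH¹` with `τ = S² Ξʳ_η` if
`Ext_{H^op}^n(k_ε, H)` is one-dimensional (`orbitExt_leftFactor_mul`).

*Injectivity.* If `σ c = 0`, then `c ⊗ 1` annihilates `Ext_A^n(H, A)`. But from the other side this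
is the nonzero module `Ext_{H^op}^n(k_ε, H) ⊗ H`, and `c ⊗ 1` multiplies the second factor by `c`.
So `c = 0`, and since `Ξˡ_ξ` is bijective, `S` is injective.

*Bijectivity and `S⁴`.* If both are one-dimensional in the same degree, there is a bijection `θ`
with `θ (d w σ(c)) = τ(d) θ(w) c` (`exists_twisted_bijection`). The regularity assumption makes
`u = θ 1` a unit (`isUnit_of_twisted_bijection`). Then `θ d = τ(d) u` shows that `τ` is surjective,
hence `S` is, and `u c = θ (σ c) = τ(σ c) u` shows that `τ ∘ σ` is inner. Finally
`τ ∘ σ = S⁴ Ξˡ_ξ Ξʳ_η`, as the winding automorphisms commute with each other and with `S²`.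
-/

namespace HopfExt

open CategoryTheory TensorProduct Coalgebra HopfAlgebra WithConv

/-! ### Twisting a tensor product by convolution -/

noncomputable section Twist

variable {k H K : Type*} [Field k] [Ring H] [HopfAlgebra k H] [Ring K] [Algebra k K]

/-- The endomorphism `h ⊗ y ↦ h₁ ⊗ c(h₂) y` of `H ⊗ K`. -/
def twistRight (c : H →ₗ[k] K) : H ⊗[k] K →ₗ[k] H ⊗[k] K :=
  LinearMap.lTensor H (LinearMap.mul' k K ∘ₗ LinearMap.rTensor K c) ∘ₗ
    (TensorProduct.assoc k H H K).toLinearMap ∘ₗ LinearMap.rTensor K comul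

/-- The endomorphism `y ⊗ h ↦ y c(h₁) ⊗ h₂` of `K ⊗ H`. -/
def twistLeft (c : H →ₗ[k] K) : K ⊗[k] H →ₗ[k] K ⊗[k] H :=
  LinearMap.rTensor H (LinearMap.mul' k K ∘ₗ LinearMap.lTensor K c) ∘ₗ
    (TensorProduct.assoc k K H H).symm.toLinearMap ∘ₗ LinearMap.lTensor K comul

theorem twistRight_tmul (c : H →ₗ[k] K) (h : H) (y : K) :
    twistRight c (h ⊗ₜ y) =
      ∑ i ∈ (ℛ k h).index, (ℛ k h).left i ⊗ₜ[k] (c ((ℛ k h).right i) * y) := by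
  simp only [twistRight, LinearMap.comp_apply, LinearMap.rTensor_tmul]
  conv_lhs => rw [← (ℛ k h).eq]
  simp [TensorProduct.sum_tmul, map_sum]

theorem twistLeft_tmul (c : H →ₗ[k] K) (h : H) (y : K) :
    twistLeft c (y ⊗ₜ h) =
      ∑ i ∈ (ℛ k h).index, (y * c ((ℛ k h).left i)) ⊗ₜ[k] (ℛ k h).right i := by
  simp only [twistLeft, LinearMap.comp_apply, LinearMap.lTensor_tmul]
  conv_lhs => rw [← (ℛ k h).eq]
  simp [TensorProduct.tmul_sum, map_sum]

theorem twistRight_eq_convMul (c : H →ₗ[k] K) (h : H) (y : K) :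
    twistRight c (h ⊗ₜ y) =
      (toConv (Algebra.TensorProduct.includeLeft (R := k) (S := k) (A := H) (B := K)).toLinearMap *
        toConv (Algebra.TensorProduct.includeRight.toLinearMap ∘ₗ c) :
          WithConv (H →ₗ[k] H ⊗[k] K)) h * (1 ⊗ₜ y) := by
  rw [twistRight_tmul, (ℛ k h).convMul_apply]
  simp [Finset.sum_mul]

theorem twistLeft_eq_convMul (c : H →ₗ[k] K) (h : H) (y : K) :
    twistLeft c (y ⊗ₜ h) = (y ⊗ₜ 1) *
      (toConv ((Algebra.TensorProduct.includeLeft (R := k) (S := k) (A := K)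
          (B := H)).toLinearMap ∘ₗ c) *
        toConv Algebra.TensorProduct.includeRight.toLinearMap :
          WithConv (H →ₗ[k] K ⊗[k] H)) h := by
  rw [twistLeft_tmul, (ℛ k h).convMul_apply]
  simp [Finset.mul_sum]

/-- Twisting turns convolution into composition, by (co)associativity. -/
theorem twistRight_comp (c d : H →ₗ[k] K) :
    twistRight c ∘ₗ twistRight d = twistRight (toConv c * toConv d).ofConv := by
  ext h y
  simp only [AlgebraTensorModule.curry_apply, curry_apply, LinearMap.coe_restrictScalars,
    LinearMap.comp_apply]
  rw [twistRight_tmul d, map_sum, twistRight_eq_convMul]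
  simp only [twistRight_eq_convMul]
  have key := LinearMap.algHom_comp_convMul_distrib
    (Algebra.TensorProduct.includeRight (R := k) (A := H) (B := K)) (toConv c) (toConv d)
  simp only at key
  rw [key, toConv_ofConv, ← mul_assoc, (ℛ k h).convMul_apply, Finset.sum_mul]
  refine Finset.sum_congr rfl fun i _ => ?_
  simp [mul_assoc]

theorem twistLeft_comp (c d : H →ₗ[k] K) :
    twistLeft c ∘ₗ twistLeft d = twistLeft (toConv d * toConv c).ofConv := by
  ext y h
  simp only [AlgebraTensorModule.curry_apply, curry_apply, LinearMap.coe_restrictScalars,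
    LinearMap.comp_apply]
  rw [twistLeft_tmul d, map_sum, twistLeft_eq_convMul]
  simp only [twistLeft_eq_convMul]
  have key := LinearMap.algHom_comp_convMul_distrib
    (Algebra.TensorProduct.includeLeft (R := k) (S := k) (A := K) (B := H)) (toConv d) (toConv c)
  simp only at key
  rw [key, toConv_ofConv, mul_assoc, (ℛ k h).convMul_apply, Finset.mul_sum]
  refine Finset.sum_congr rfl fun i _ => ?_
  simp [← mul_assoc]

theorem twistRight_one : twistRight (1 : WithConv (H →ₗ[k] K)).ofConv = LinearMap.id := by
  ext h y
  simp only [AlgebraTensorModule.curry_apply, curry_apply, LinearMap.coe_restrictScalars]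
  rw [twistRight_eq_convMul]
  have : (toConv (Algebra.TensorProduct.includeRight (R := k) (A := H) (B := K).toLinearMap ∘ₗ
      (1 : WithConv (H →ₗ[k] K)).ofConv)) = 1 := by
    ext x; simp [LinearMap.convOne_def, Algebra.algebraMap_eq_smul_one,
      Algebra.TensorProduct.one_def]
  rw [this, mul_one]; simp

theorem twistLeft_one : twistLeft (1 : WithConv (H →ₗ[k] K)).ofConv = LinearMap.id := by
  ext y h
  simp only [AlgebraTensorModule.curry_apply, curry_apply, LinearMap.coe_restrictScalars]
  rw [twistLeft_eq_convMul]
  have : (toConv ((Algebra.TensorProduct.includeLeft (R := k) (S := k) (A := K)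
      (B := H)).toLinearMap ∘ₗ (1 : WithConv (H →ₗ[k] K)).ofConv)) = 1 := by
    ext x; simp [LinearMap.convOne_def]
  rw [this, one_mul]; simp

theorem twistRight_bijective {c d : H →ₗ[k] K} (hcd : toConv c * toConv d = 1)
    (hdc : toConv d * toConv c = 1) : Function.Bijective (twistRight c) :=
  Function.bijective_iff_has_inverse.2 ⟨twistRight d,
    fun x => by simpa [hdc, twistRight_one] using congr($(twistRight_comp d c) x),
    fun x => by simpa [hcd, twistRight_one] using congr($(twistRight_comp c d) x)⟩

theorem twistLeft_bijective {c d : H →ₗ[k] K} (hcd : toConv c * toConv d = 1)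
    (hdc : toConv d * toConv c = 1) : Function.Bijective (twistLeft c) :=
  Function.bijective_iff_has_inverse.2 ⟨twistLeft d,
    fun x => by simpa [hcd, twistLeft_one] using congr($(twistLeft_comp d c) x),
    fun x => by simpa [hdc, twistLeft_one] using congr($(twistLeft_comp c d) x)⟩

end Twist

/-! ### Winding automorphisms and the antipode -/

noncomputable section Winding

variable {k H : Type u} [Field k] [Ring H] [HopfAlgebra k H]

/-- The linear map `a ↦ ξ(a) 1`, as an element of the convolution algebra of endomorphisms. -/
def charConv (ξ : H →ₐ[k] k) : WithConv (H →ₗ[k] H) :=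
  toConv (Algebra.linearMap k H ∘ₗ ξ.toLinearMap)

theorem toConv_rightWinding (ξ : H →ₐ[k] k) :
    toConv (rightWinding ξ).toLinearMap = toConv LinearMap.id * charConv ξ := by
  ext a
  rw [(ℛ k a).convMul_apply]
  simp [rightWinding_apply ξ (ℛ k a), charConv, Algebra.smul_def, Algebra.commutes]

theorem toConv_leftWinding (ξ : H →ₐ[k] k) :
    toConv (leftWinding ξ).toLinearMap = charConv ξ * toConv LinearMap.id := by
  ext a
  rw [(ℛ k a).convMul_apply]
  simp [leftWinding_apply ξ (ℛ k a), charConv, Algebra.smul_def]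

/-- The character `ξ ∘ S`, the convolution inverse of `ξ`. -/
def antipodeChar (ξ : H →ₐ[k] k) : H →ₐ[k] k :=
  AlgHom.ofLinearMap (ξ.toLinearMap ∘ₗ antipode k (A := H)) (by simp)
    (fun x y => by simp [antipode_mul_antidistrib, mul_comm])

@[simp]
theorem antipodeChar_apply (ξ : H →ₐ[k] k) (a : H) : antipodeChar ξ a = ξ (antipode k a) := rfl

theorem charConv_mul_antipodeChar (ξ : H →ₐ[k] k) :
    charConv ξ * charConv (antipodeChar ξ) = 1 := by
  ext a
  rw [(ℛ k a).convMul_apply]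
  simpa [charConv] using congr(algebraMap k H (ξ
    $(sum_mul_antipode_eq_algebraMap_counit (ℛ k a))))

theorem antipodeChar_mul_charConv (ξ : H →ₐ[k] k) :
    charConv (antipodeChar ξ) * charConv ξ = 1 := by
  ext a
  rw [(ℛ k a).convMul_apply]
  simpa [charConv] using congr(algebraMap k H (ξ
    $(sum_antipode_mul_eq_algebraMap_counit (ℛ k a))))

theorem charConv_injective : Function.Injective (charConv : (H →ₐ[k] k) → _) := by
  intro ξ ζ h
  ext a
  have := congr(counit (R := k) ($h a))
  simpa [charConv] using this

/-- `ξ ∘ S² = ξ`: both characters are the convolution inverse of `ξ ∘ S`. -/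
theorem antipodeChar_antipodeChar (ξ : H →ₐ[k] k) : antipodeChar (antipodeChar ξ) = ξ :=
  charConv_injective (left_inv_eq_right_inv (antipodeChar_mul_charConv _)
    (antipodeChar_mul_charConv ξ))

theorem toConv_algHom_comp_charConv (f : H →ₐ[k] H) (ξ : H →ₐ[k] k) :
    toConv (f.toLinearMap ∘ₗ (charConv ξ).ofConv) = charConv ξ := by
  ext a; simp [charConv]

theorem toConv_algHom_comp_mul (f : H →ₐ[k] H) (g h : WithConv (H →ₗ[k] H)) :
    toConv (f.toLinearMap ∘ₗ (g * h).ofConv) =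
      toConv (f.toLinearMap ∘ₗ g.ofConv) * toConv (f.toLinearMap ∘ₗ h.ofConv) := by
  rw [LinearMap.algHom_comp_convMul_distrib, toConv_ofConv]

theorem leftWinding_surjective (ξ : H →ₐ[k] k) : Function.Surjective (leftWinding ξ) := by
  have h : toConv ((leftWinding ξ).toLinearMap ∘ₗ (leftWinding (antipodeChar ξ)).toLinearMap) =
      toConv LinearMap.id := by
    rw [← ofConv_toConv (leftWinding (antipodeChar ξ)).toLinearMap, toConv_leftWinding,
      toConv_algHom_comp_mul, toConv_algHom_comp_charConv, ofConv_toConv, LinearMap.comp_id,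
      toConv_leftWinding, ← mul_assoc, antipodeChar_mul_charConv, one_mul]
  exact fun a => ⟨leftWinding (antipodeChar ξ) a, congr($(toConv_injective h) a)⟩

theorem rightWinding_surjective (ξ : H →ₐ[k] k) : Function.Surjective (rightWinding ξ) := by
  have h : toConv ((rightWinding ξ).toLinearMap ∘ₗ (rightWinding (antipodeChar ξ)).toLinearMap) =
      toConv LinearMap.id := by
    rw [← ofConv_toConv (rightWinding (antipodeChar ξ)).toLinearMap, toConv_rightWinding,
      toConv_algHom_comp_mul, toConv_algHom_comp_charConv, ofConv_toConv, LinearMap.comp_id,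
      toConv_rightWinding, mul_assoc, charConv_mul_antipodeChar, mul_one]
  exact fun a => ⟨rightWinding (antipodeChar ξ) a, congr($(toConv_injective h) a)⟩

theorem leftWinding_rightWinding_comm (ξ η : H →ₐ[k] k) (a : H) :
    leftWinding ξ (rightWinding η a) = rightWinding η (leftWinding ξ a) := by
  have h : toConv ((leftWinding ξ).toLinearMap ∘ₗ (rightWinding η).toLinearMap) =
      toConv ((rightWinding η).toLinearMap ∘ₗ (leftWinding ξ).toLinearMap) := by
    rw [← ofConv_toConv (rightWinding η).toLinearMap, ← ofConv_toConv (leftWinding ξ).toLinearMap,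
      toConv_rightWinding, toConv_leftWinding, ← toConv_rightWinding, ← toConv_leftWinding,
      ofConv_toConv, ofConv_toConv]
    conv_lhs => rw [← ofConv_toConv (rightWinding η).toLinearMap, toConv_rightWinding,
      toConv_algHom_comp_mul, toConv_algHom_comp_charConv, ofConv_toConv, LinearMap.comp_id,
      toConv_leftWinding]
    conv_rhs => rw [← ofConv_toConv (leftWinding ξ).toLinearMap, toConv_leftWinding,
      toConv_algHom_comp_mul, toConv_algHom_comp_charConv, ofConv_toConv, LinearMap.comp_id,
      toConv_rightWinding]
    rw [mul_assoc]
  exact congr($(toConv_injective h) a)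

theorem toConv_algHom_comp_antipode_mul (f : H →ₐ[k] H) :
    toConv (f.toLinearMap ∘ₗ antipode k (A := H)) * toConv f.toLinearMap = 1 := by
  have := toConv_algHom_comp_mul f (toConv (antipode k (A := H))) (toConv LinearMap.id)
  rw [LinearMap.antipode_mul_id] at this
  rw [ofConv_toConv, ofConv_toConv, LinearMap.comp_id] at this
  rw [← this]
  ext a; simp

/-- Both sides are convolution inverses of the algebra map `leftWinding ξ`. -/
theorem toConv_antipode_comp_rightWinding (ξ : H →ₐ[k] k) :
    toConv (antipode k (A := H) ∘ₗ (rightWinding (antipodeChar ξ)).toLinearMap) =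
      toConv ((leftWinding ξ).toLinearMap ∘ₗ antipode k (A := H)) := by
  symm
  refine left_inv_eq_right_inv (toConv_algHom_comp_antipode_mul _) ?_
  have : toConv (antipode k (A := H) ∘ₗ (rightWinding (antipodeChar ξ)).toLinearMap) =
      toConv (antipode k (A := H)) * charConv (antipodeChar ξ) := by
    ext a
    rw [(ℛ k a).convMul_apply]
    simp [rightWinding_apply _ (ℛ k a), charConv, ← Algebra.commutes, ← Algebra.smul_def]
  rw [this, toConv_leftWinding, mul_assoc, ← mul_assoc (toConv LinearMap.id),
    LinearMap.id_mul_antipode, one_mul, charConv_mul_antipodeChar]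

theorem leftWinding_antipode (ξ : H →ₐ[k] k) (a : H) :
    leftWinding ξ (antipode k a) = antipode k (rightWinding (antipodeChar ξ) a) :=
  congr($(toConv_injective (toConv_antipode_comp_rightWinding ξ)) a).symm

theorem rightWinding_antipode (ξ : H →ₐ[k] k) (a : H) :
    rightWinding ξ (antipode k a) = antipode k (leftWinding (antipodeChar ξ) a) := by
  have h : toConv ((rightWinding ξ).toLinearMap ∘ₗ antipode k (A := H)) =
      toConv (antipode k (A := H) ∘ₗ (leftWinding (antipodeChar ξ)).toLinearMap) := by
    refine left_inv_eq_right_inv (toConv_algHom_comp_antipode_mul _) ?_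
    have : toConv (antipode k (A := H) ∘ₗ (leftWinding (antipodeChar ξ)).toLinearMap) =
        charConv (antipodeChar ξ) * toConv (antipode k (A := H)) := by
      ext a
      rw [(ℛ k a).convMul_apply]
      simp [leftWinding_apply _ (ℛ k a), charConv, ← Algebra.smul_def]
    rw [this, toConv_rightWinding, mul_assoc, ← mul_assoc (charConv ξ),
      charConv_mul_antipodeChar, one_mul, LinearMap.id_mul_antipode]
  exact congr($(toConv_injective h) a)

/-- The winding automorphisms commute with `S²`. -/
theorem rightWinding_antipode_sq (ξ : H →ₐ[k] k) (a : H) :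
    rightWinding ξ (antipode k (antipode k a)) = antipode k (antipode k (rightWinding ξ a)) := by
  rw [rightWinding_antipode, leftWinding_antipode, antipodeChar_antipodeChar]

end Winding

/-! ### Finitary `Ext` groups and change of rings -/

noncomputable section GeneralExt

variable {k A B : Type u} [Field k] [Ring A] [Algebra k A] [Ring B] [Algebra k B]

/-- A compactness property of the functor `Ext^n(X, -)`: if endomorphisms `p s` of `N`, indexed by
the finite subsets `s` of some type, eventually fix each element of `N`, then each class in
`Ext^n(X, N)` is fixed by some `p s`. In contrast to having a resolution by finitely generated
projectives, this can be carried from left to right `H`-modules by `IsFinitaryExt.transfer`. -/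
def IsFinitaryExt (X : ModuleCat.{u} B) (n : ℕ) : Prop :=
  ∀ (ι : Type u) (N : ModuleCat.{u} B) (p : Finset ι → (N ⟶ N)),
    (∀ x : N, ∃ s, ∀ t, s ⊆ t → (p t).hom x = x) →
    ∀ y : Abelian.Ext.{u} X N n, ∃ s, y.comp (Abelian.Ext.mk₀ (p s)) (add_zero n) = y

/-- A class in `Ext^n(X, N)` is represented by a map from the finitely generated module `P_n`, and
`p s` fixes the images of the finitely many generators for large `s`. -/
theorem HasFGProjectiveResolution.isFinitaryExt {X : ModuleCat.{u} B}
    (h : HasFGProjectiveResolution X) (n : ℕ) : IsFinitaryExt X n := by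
  classical
  obtain ⟨P, hP⟩ := h
  intro ι N p hp y
  obtain ⟨f, hf, rfl⟩ := P.extMk_surjective y (n + 1) rfl
  obtain ⟨g, hg⟩ := (hP n).fg_top
  choose s hs using fun x : N => hp x
  let t : Finset ι := g.biUnion fun x => s (f.hom x)
  refine ⟨t, ?_⟩
  rw [P.extMk_comp_mk₀]
  congr 1
  ext1
  refine LinearMap.ext_on hg fun x hx => ?_
  exact hs _ _ (Finset.subset_biUnion_of_mem (fun x => s (f.hom x)) hx)

/-- Restriction of modules along the algebra map `δ`. -/
abbrev res (δ : B →ₐ[k] A) : ModuleCat.{u} A ⥤ ModuleCat.{u} B :=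
  ModuleCat.restrictScalars δ.toRingHom

instance (δ : B →ₐ[k] A) : Limits.PreservesFiniteLimits (res δ) :=
  ⟨fun _ _ _ => ⟨inferInstance⟩⟩

instance (δ : B →ₐ[k] A) : Limits.PreservesFiniteColimits (res δ) :=
  ⟨fun _ _ _ => ⟨inferInstance⟩⟩

/-- If `A ≃ W ⊗ B` as right `B`-modules, then the `B`-module `Hom_k(A, V) ≃ Hom_k(B, Hom_k(W, V))`
is coinduced from the field `k`, so it is injective. The extension of a map along `f : X ⟶ Y` is
written down from a `k`-linear retraction of `f`. -/
theorem injective_res_coextend (δ : B →ₐ[k] A) {W : Type u} [AddCommGroup W] [Module k W]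
    (j : W →ₗ[k] A)
    (hα : Function.Bijective (TensorProduct.lift ((LinearMap.mul k A).compl₁₂ j δ.toLinearMap)))
    (V : ModuleCat.{u} k) :
    Injective ((res δ).obj ((ModuleCat.coextendScalars (algebraMap k A)).obj V)) := by
  refine ⟨fun {X Y} g f hf => ?_⟩
  let α := LinearEquiv.ofBijective _ hα
  have hα_tmul (w : W) (b : B) : α (w ⊗ₜ b) = j w * δ b := by simp [α]
  let _ : Module k X := Module.compHom X (algebraMap k B)
  let _ : Module k Y := Module.compHom Y (algebraMap k B)
  have _ : IsScalarTower k B Y := ⟨fun c b y => by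
    rw [Algebra.smul_def, mul_smul]; rfl⟩
  let f' : X →ₗ[k] Y :=
    { toFun := f.hom, map_add' := map_add f.hom, map_smul' := fun c x => map_smul f.hom _ x }
  have hf' : LinearMap.ker f' = ⊥ := LinearMap.ker_eq_bot.2 ((ModuleCat.mono_iff_injective f).1 hf)
  obtain ⟨r, hr⟩ := f'.exists_leftInverse_of_injective hf'
  have hrf (x : X) : r (f.hom x) = x := congr($hr x)
  -- `ev x : A → V` is the function that `g x` is.
  let ev (x : X) (a : A) : V := (ModuleCat.CoextendScalars.equiv _ V (g.hom x)) a
  have ev_add (x x' : X) (a : A) : ev (x + x') a = ev x a + ev x' a := by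
    simp only [ev, map_add]; rfl
  have ev_add' (x : X) (a a' : A) : ev x (a + a') = ev x a + ev x a' :=
    map_add (ModuleCat.CoextendScalars.equiv _ V (g.hom x)) a a'
  have ev_smul' (x : X) (c : k) (a : A) : ev x (c • a) = c • ev x a := by
    rw [Algebra.smul_def]
    exact (ModuleCat.CoextendScalars.equiv _ V (g.hom x)).map_smul' c a
  have ev_smul (x : X) (b : B) (a : A) : ev (b • x) a = ev x (a * δ b) := by
    simp only [ev, map_smul]; rfl
  -- In terms of `A ≃ W ⊗ B`, the extension of `g` takes `y` to `w ⊗ b ↦ ev (r (b y)) (j w)`.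
  let Φ (y : Y) : W ⊗[k] B →ₗ[k] V := TensorProduct.lift
    (LinearMap.mk₂ k (fun w b => ev (r (b • y)) (j w))
      (fun w w' b => by simp [ev_add']) (fun c w b => by simp [ev_smul'])
      (fun w b b' => by simp [add_smul, ev_add])
      (fun c w b => by
        rw [smul_assoc, map_smul]
        change ev ((algebraMap k B c) • r (b • y)) (j w) = _
        rw [ev_smul, AlgHom.commutes, ← Algebra.commutes, ← Algebra.smul_def, ev_smul']))
  have Φ_tmul (y : Y) (w : W) (b : B) : Φ y (w ⊗ₜ b) = ev (r (b • y)) (j w) := by simp [Φ]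
  have Φ_add (y y' : Y) : Φ (y + y') = Φ y + Φ y' := by
    ext w b; simp [Φ_tmul, ev_add]
  have Φ_smul (b : B) (y : Y) (a : A) : Φ (b • y) (α.symm a) = Φ y (α.symm (a * δ b)) := by
    obtain ⟨t, rfl⟩ := α.surjective a
    induction t with
    | zero => simp
    | add t t' h h' => simp only [map_add, add_mul, h, h']
    | tmul w b' =>
      have : α (w ⊗ₜ b') * δ b = α (w ⊗ₜ (b' * b)) := by
        rw [hα_tmul, hα_tmul, map_mul, mul_assoc]
      rw [this, LinearEquiv.symm_apply_apply, LinearEquiv.symm_apply_apply, Φ_tmul, Φ_tmul,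
        mul_smul]
  have Φ_comp (x : X) (a : A) : Φ (f.hom x) (α.symm a) = ev x a := by
    obtain ⟨t, rfl⟩ := α.surjective a
    rw [LinearEquiv.symm_apply_apply]
    induction t with
    | zero => simpa using (ev_smul' x 0 0).symm
    | add t t' h h' => simp only [map_add, ev_add', h, h']
    | tmul w b => rw [Φ_tmul, ← map_smul, hrf, ev_smul, hα_tmul]
  let F (y : Y) : (ModuleCat.coextendScalars (algebraMap k A)).obj V :=
    (ModuleCat.CoextendScalars.equiv _ V).symm
      { toFun := fun a => Φ y (α.symm a)
        map_add' := fun a a' =>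
          (congrArg (Φ y) (map_add α.symm a a')).trans (map_add _ _ _)
        map_smul' := fun c a => by
          change Φ y (α.symm (algebraMap k A c * (show A from a))) = _
          rw [← Algebra.smul_def, map_smul, map_smul]; rfl }
  refine ⟨ModuleCat.ofHom (Y := (res δ).obj ((ModuleCat.coextendScalars (algebraMap k A)).obj V))
    { toFun := F
      map_add' := fun y y' => ?_
      map_smul' := fun b y => ?_ }, ?_⟩
  · apply (ModuleCat.CoextendScalars.equiv _ V).injective
    refine LinearMap.ext fun a => ?_
    exact congr($(Φ_add y y') (α.symm a))
  · apply (ModuleCat.CoextendScalars.equiv _ V).injective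
    refine LinearMap.ext fun a => ?_
    exact Φ_smul b y a
  · ext x
    apply (ModuleCat.CoextendScalars.equiv _ V).injective
    refine LinearMap.ext fun a => ?_
    exact Φ_comp x a

theorem injective_coextend (V : ModuleCat.{u} k) :
    Injective ((ModuleCat.coextendScalars (algebraMap k A)).obj V) := by
  refine injective_res_coextend (AlgHom.id k A) (Algebra.linearMap k A) ?_ V
  have : TensorProduct.lift ((LinearMap.mul k A).compl₁₂ (Algebra.linearMap k A)
      (AlgHom.id k A).toLinearMap) = (TensorProduct.lid k A).toLinearMap := by
    ext; simp
  rw [this]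
  exact (TensorProduct.lid k A).bijective

/-- The comparison map `Ext_A^n(E, M) → Ext_B^n(X, M)` for a `B`-linear map `u : X → E`: restrict
along `δ`, then compose with `u`. -/
def resExt (δ : B →ₐ[k] A) {X : ModuleCat.{u} B} {E : ModuleCat.{u} A} (u : X ⟶ (res δ).obj E)
    (M : ModuleCat.{u} A) (n : ℕ) (z : Abelian.Ext.{u} E M n) :
    Abelian.Ext.{u} X ((res δ).obj M) n :=
  (Abelian.Ext.mk₀ u).comp (z.mapExactFunctor (res δ)) (zero_add n)

section resExt

variable (δ : B →ₐ[k] A) {X : ModuleCat.{u} B} {E : ModuleCat.{u} A} (u : X ⟶ (res δ).obj E)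

theorem resExt_comp {M N : ModuleCat.{u} A} {a b c : ℕ} (z : Abelian.Ext.{u} E M a)
    (w : Abelian.Ext.{u} M N b) (h : a + b = c) :
    resExt δ u N c (z.comp w h) =
      (resExt δ u M a z).comp (w.mapExactFunctor (res δ)) h := by
  rw [resExt, resExt, Abelian.Ext.mapExactFunctor_comp, Abelian.Ext.comp_assoc]
  omega

theorem resExt_comp_mk₀ {M N : ModuleCat.{u} A} {n : ℕ} (z : Abelian.Ext.{u} E M n)
    (f : M ⟶ N) :
    resExt δ u N n (z.comp (Abelian.Ext.mk₀ f) (add_zero n)) =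
      (resExt δ u M n z).comp (Abelian.Ext.mk₀ ((res δ).map f)) (add_zero n) := by
  rw [resExt_comp, Abelian.Ext.mapExactFunctor_mk₀]

theorem resExt_add (M : ModuleCat.{u} A) (n : ℕ) (z w : Abelian.Ext.{u} E M n) :
    resExt δ u M n (z + w) = resExt δ u M n z + resExt δ u M n w := by
  simp [resExt]

theorem resExt_sub (M : ModuleCat.{u} A) (n : ℕ) (z w : Abelian.Ext.{u} E M n) :
    resExt δ u M n (z - w) = resExt δ u M n z - resExt δ u M n w :=
  (AddMonoidHom.mk' _ (resExt_add δ u M n)).map_sub z w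

/-- The comparison map is bijective in all degrees if it is so in degree `0` (that is, `u`
identifies `E` with the module induced from `X`) and `A` is free as a right `B`-module. The proof is
by dimension shifting, along the embedding of `M` into the coextended module `Hom_k(A, M)`, which is
injective over `A` and over `B`. -/
theorem resExt_bijective {W : Type u} [AddCommGroup W] [Module k W]
    (j : W →ₗ[k] A)
    (hα : Function.Bijective (TensorProduct.lift ((LinearMap.mul k A).compl₁₂ j δ.toLinearMap)))
    (hu : ∀ M : ModuleCat.{u} A,
      Function.Bijective fun f : E ⟶ M => u ≫ (res δ).map f) (n : ℕ) :
    ∀ M : ModuleCat.{u} A, Function.Bijective (resExt δ u M n) := by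
  induction n with
  | zero =>
    intro M
    have key : resExt δ u M 0 = Abelian.Ext.mk₀ ∘ (fun f : E ⟶ M => u ≫ (res δ).map f) ∘
        Abelian.Ext.homEquiv₀ := by
      ext z
      obtain ⟨f, rfl⟩ := Abelian.Ext.homEquiv₀.symm.surjective z
      rw [Function.comp_apply, Function.comp_apply, Equiv.apply_symm_apply]
      simp [resExt, Abelian.Ext.mapExactFunctor_mk₀]
    rw [key]
    exact (Abelian.Ext.mk₀_bijective _ _).comp ((hu M).comp Abelian.Ext.homEquiv₀.bijective)
  | succ n ih =>
    intro M
    let I : ModuleCat.{u} A := (ModuleCat.coextendScalars (algebraMap k A)).obj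
      ((ModuleCat.restrictScalars (algebraMap k A)).obj M)
    let i : M ⟶ I := (ModuleCat.restrictCoextendScalarsAdj.{u, u, u} (algebraMap k A)).unit.app M
    have hi : Mono i := by
      rw [ModuleCat.mono_iff_injective]
      intro m m' h
      have := congr(ModuleCat.CoextendScalars.equiv _ _ $h (1 : A))
      change (1 : A) • m = (1 : A) • m' at this
      simpa using this
    have : Injective I := injective_coextend _
    have hI : Injective ((res δ).obj I) := injective_res_coextend δ j hα _
    let T : ShortComplex (ModuleCat.{u} A) := ShortComplex.mk i (Limits.cokernel.π i) (by simp)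
    have hT : T.ShortExact :=
      { exact := T.exact_of_g_is_cokernel (Limits.cokernelIsCokernel i)
        mono_f := hi
        epi_g := inferInstanceAs (Epi (Limits.cokernel.π i)) }
    have hT' := hT.map_of_exact (res δ)
    constructor
    · intro z w hzw
      rw [← sub_eq_zero] at hzw ⊢
      rw [← resExt_sub] at hzw
      generalize z - w = z at hzw ⊢
      obtain ⟨y, rfl⟩ := Abelian.Ext.covariant_sequence_exact₁ E hT z
        (Abelian.Ext.eq_zero_of_injective _) rfl
      rw [resExt_comp, Abelian.Ext.mapExactFunctor_extClass] at hzw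
      obtain ⟨v, hv⟩ := Abelian.Ext.covariant_sequence_exact₃ X hT' _ rfl hzw
      obtain ⟨v, rfl⟩ := (ih _).2 v
      have : v.comp (Abelian.Ext.mk₀ T.g) (add_zero n) = y := by
        apply (ih _).1
        rw [resExt_comp_mk₀]
        exact hv
      rw [← this, Abelian.Ext.comp_assoc_of_second_deg_zero, hT.comp_extClass,
        Abelian.Ext.comp_zero]
    · intro y
      obtain ⟨x, rfl⟩ := Abelian.Ext.covariant_sequence_exact₁ X hT' y
        (haveI := hI; Abelian.Ext.eq_zero_of_injective (I := (res δ).obj I) _) rfl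
      obtain ⟨z, rfl⟩ := (ih _).2 x
      refine ⟨z.comp hT.extClass rfl, ?_⟩
      rw [resExt_comp, Abelian.Ext.mapExactFunctor_extClass]
      rfl

end resExt

end GeneralExt

/-! ### `Ext` with coefficients in a free extension -/

noncomputable section Coefficients

variable {k A B B' : Type u} [Field k] [Ring A] [Algebra k A] [Ring B] [Algebra k B]
  [Ring B'] [Algebra k B']

/-- If both `Ext_B^n(X, -)` and `Ext_{B'}^n(X', -)` compute `Ext_A^n(E, -)`, then finitarity passes
from `X` to `X'`. The retraction `aug` of `δ'` turns every `B'`-module into an `A`-module in a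
functorial way. -/
theorem IsFinitaryExt.transfer {δ : B →ₐ[k] A} {δ' : B' →ₐ[k] A} {X : ModuleCat.{u} B}
    {X' : ModuleCat.{u} B'} {E : ModuleCat.{u} A} {u : X ⟶ (res δ).obj E}
    {u' : X' ⟶ (res δ').obj E} {n : ℕ}
    (hu : ∀ M, Function.Injective (resExt δ u M n))
    (hu' : ∀ M, Function.Surjective (resExt δ' u' M n))
    (aug : A →ₐ[k] B') (haug : ∀ b, aug (δ' b) = b) (h : IsFinitaryExt X n) :
    IsFinitaryExt X' n := by
  intro ι N p hp y
  let M : ModuleCat.{u} A := (res aug).obj N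
  -- `κ` and `κ'` are the identity of `N`, as `aug ∘ δ' = id`.
  let κ : N ⟶ (res δ').obj M := ModuleCat.ofHom (Y := (res δ').obj M)
    { toFun := fun x => x
      map_add' := fun _ _ => rfl
      map_smul' := fun b x => by
        change b • x = aug (δ' b) • x
        rw [haug] }
  let κ' : (res δ').obj M ⟶ N := ModuleCat.ofHom (X := (res δ').obj M)
    { toFun := fun x => x
      map_add' := fun _ _ => rfl
      map_smul' := fun b x => by
        change aug (δ' b) • (show N from x) = b • (show N from x)
        rw [haug] }
  have hκ : κ ≫ κ' = 𝟙 N := rfl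
  obtain ⟨z, hz⟩ := hu' _ (y.comp (Abelian.Ext.mk₀ κ) (add_zero n))
  obtain ⟨s, hs⟩ := h ι ((res δ).obj M) (fun s => (res δ).map ((res aug).map (p s)))
    (fun x => hp x) (resExt δ u M n z)
  refine ⟨s, ?_⟩
  rw [← resExt_comp_mk₀] at hs
  have hs' := congrArg (resExt δ' u' M n) (hu _ hs)
  rw [resExt_comp_mk₀, hz] at hs'
  have hcomm : κ ≫ (res δ').map ((res aug).map (p s)) ≫ κ' = p s := rfl
  have := congr(($hs').comp (Abelian.Ext.mk₀ κ') (add_zero n))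
  simpa only [Abelian.Ext.comp_assoc_of_third_deg_zero, Abelian.Ext.mk₀_comp_mk₀, Category.assoc,
    hκ, hcomm, Abelian.Ext.comp_mk₀_id] using this

theorem _root_.ModuleCat.hom_finsetSum_apply {ι : Type*} {M N : ModuleCat.{u} B} (f : ι → (M ⟶ N))
    (s : Finset ι) (x : M) : (∑ i ∈ s, f i).hom x = ∑ i ∈ s, (f i).hom x := by
  simp [ModuleCat.hom_sum]

theorem comp_mk₀_finsetSum {ι : Type*} {L M N : ModuleCat.{u} B} {n : ℕ}
    (y : Abelian.Ext.{u} L M n) (f : ι → (M ⟶ N)) (s : Finset ι) :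
    y.comp (Abelian.Ext.mk₀ (∑ i ∈ s, f i)) (add_zero n) =
      ∑ i ∈ s, y.comp (Abelian.Ext.mk₀ (f i)) (add_zero n) := by
  classical
  induction s using Finset.induction_on with
  | empty => simp
  | insert i s hi ih =>
    rw [Finset.sum_insert hi, Finset.sum_insert hi, Abelian.Ext.mk₀_add, Abelian.Ext.comp_add, ih]

/-- Right multiplication by `c`, as an endomorphism of the left module `B`. -/
def rightMul (c : B) : ModuleCat.of B B ⟶ ModuleCat.of B B :=
  ModuleCat.ofHom (LinearMap.toSpanSingleton B B c)

/-- The map `b ↦ δ(b) a` of left `B`-modules from `B` to `A`. -/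
def orbitMap (δ : B →ₐ[k] A) (a : A) : ModuleCat.of B B ⟶ (res δ).obj (ModuleCat.of A A) :=
  ModuleCat.ofHom (Y := (res δ).obj (ModuleCat.of A A))
    { toFun := fun b => δ b * a
      map_add' := fun b b' => by rw [map_add, add_mul]; rfl
      map_smul' := fun b b' => by
        change δ (b * b') * a = δ b * (δ b' * a)
        rw [map_mul, mul_assoc] }

theorem rightMul_orbitMap (δ : B →ₐ[k] A) (c : B) (a : A) :
    rightMul c ≫ orbitMap δ a = orbitMap δ (δ c * a) := by
  refine ModuleCat.hom_ext (LinearMap.ext fun b => ?_)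
  change δ (b * c) * a = δ b * (δ c * a)
  rw [map_mul, mul_assoc]

theorem orbitMap_rightMul (δ : B →ₐ[k] A) (a a' : A) :
    orbitMap δ a ≫ (res δ).map (rightMul a') = orbitMap δ (a * a') := by
  exact ModuleCat.hom_ext (LinearMap.ext fun b => mul_assoc (δ b) a a')

variable {X : ModuleCat.{u} B} {n : ℕ}

/-- The image of a class `e ∈ Ext_B^n(X, B)` in `Ext_B^n(X, A)` under `b ↦ δ(b) a`, as a function of
`a`. -/
def orbitExt (δ : B →ₐ[k] A) (e : Abelian.Ext.{u} X (ModuleCat.of B B) n) :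
    A →ₗ[k] Abelian.Ext.{u} X ((res δ).obj (ModuleCat.of A A)) n where
  toFun a := e.comp (Abelian.Ext.mk₀ (orbitMap δ a)) (add_zero n)
  map_add' a a' := by
    rw [← Abelian.Ext.comp_add, ← Abelian.Ext.mk₀_add]
    congr 2
    exact ModuleCat.hom_ext (LinearMap.ext fun b => mul_add (δ b) a a')
  map_smul' c a := by
    rw [RingHom.id_apply, ← Abelian.Ext.comp_smul, ← Abelian.Ext.mk₀_smul]
    congr 2
    refine ModuleCat.hom_ext (LinearMap.ext fun b => ?_)
    change δ b * (c • a) = δ (algebraMap k B c) * (δ b * a)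
    rw [AlgHom.commutes, ← Algebra.smul_def, mul_smul_comm]

theorem orbitExt_apply (δ : B →ₐ[k] A) (e : Abelian.Ext.{u} X (ModuleCat.of B B) n) (a : A) :
    orbitExt δ e a = e.comp (Abelian.Ext.mk₀ (orbitMap δ a)) (add_zero n) := rfl

/-- `orbitExt δ e` is linear for the right actions of `A`. -/
theorem orbitExt_comp_rightMul (δ : B →ₐ[k] A) (e : Abelian.Ext.{u} X (ModuleCat.of B B) n)
    (a a' : A) :
    (orbitExt δ e a).comp (Abelian.Ext.mk₀ ((res δ).map (rightMul a'))) (add_zero n) =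
      orbitExt δ e (a * a') := by
  rw [orbitExt_apply, Abelian.Ext.comp_assoc_of_third_deg_zero, Abelian.Ext.mk₀_comp_mk₀,
    orbitMap_rightMul, orbitExt_apply]

/-- If right multiplication by `c` scales `e` by `r`, then a left factor `δ c` of the argument can
be traded for `r`. -/
theorem orbitExt_mul (δ : B →ₐ[k] A) {e : Abelian.Ext.{u} X (ModuleCat.of B B) n} {c : B} {r : k}
    (he : e.comp (Abelian.Ext.mk₀ (rightMul c)) (add_zero n) = r • e) (a : A) :
    orbitExt δ e (δ c * a) = r • orbitExt δ e a := by
  rw [orbitExt_apply, ← rightMul_orbitMap, ← Abelian.Ext.mk₀_comp_mk₀,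
    ← Abelian.Ext.comp_assoc_of_third_deg_zero, he, Abelian.Ext.smul_comp, orbitExt_apply]

variable {W : Type u} [AddCommGroup W] [Module k W] (δ : B →ₐ[k] A) (j : W →ₗ[k] A)

/-- A factorization `B ⊗ W ≃ A`, `b ⊗ w ↦ δ(b) j(w)`, is left `B`-linear. -/
theorem factor_symm_mul
    (β : B ⊗[k] W ≃ₗ[k] A) (hβ : ∀ b w, β (b ⊗ₜ w) = δ b * j w) (b : B) (a : A) :
    β.symm (δ b * a) = b • β.symm a := by
  obtain ⟨t, rfl⟩ := β.surjective a
  rw [LinearEquiv.symm_apply_apply, LinearEquiv.symm_apply_eq]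
  induction t with
  | zero => simp
  | add t t' h h' => rw [map_add, mul_add, smul_add, map_add, h, h']
  | tmul b' w => rw [TensorProduct.smul_tmul', hβ, hβ, smul_eq_mul, map_mul, mul_assoc]

/-- The map `δ(b) j(w) ↦ f(w) b` of left `B`-modules from `A` to `B`, for a linear form `f` on `W`.
It is a coordinate function if `f` is one. -/
def coordMap (β : B ⊗[k] W ≃ₗ[k] A) (hβ : ∀ b w, β (b ⊗ₜ w) = δ b * j w) (f : Module.Dual k W) :
    (res δ).obj (ModuleCat.of A A) ⟶ ModuleCat.of B B :=
  ModuleCat.ofHom (X := (res δ).obj (ModuleCat.of A A))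
    { toFun := fun a => AlgebraTensorModule.rid k B B (AlgebraTensorModule.lTensor B B f (β.symm a))
      map_add' := fun a a' => (congrArg (fun t => AlgebraTensorModule.rid k B B
        (AlgebraTensorModule.lTensor B B f t)) (map_add β.symm a a')).trans (by
          simp only [map_add]; rfl)
      map_smul' := fun b a => (congrArg (fun t => AlgebraTensorModule.rid k B B
        (AlgebraTensorModule.lTensor B B f t)) (factor_symm_mul δ j β hβ b a)).trans (by
          simp only [map_smul]; rfl) }

theorem coordMap_apply (β : B ⊗[k] W ≃ₗ[k] A) (hβ : ∀ b w, β (b ⊗ₜ w) = δ b * j w)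
    (f : Module.Dual k W) (b : B) (w : W) :
    (coordMap δ j β hβ f).hom (β (b ⊗ₜ w)) = f w • b := by
  change AlgebraTensorModule.rid k B B (AlgebraTensorModule.lTensor B B f (β.symm (β _))) = _
  simp

variable {j} {e : Abelian.Ext.{u} X (ModuleCat.of B B) n}

/-- A coordinate map of `A` sends `orbitExt δ e (j w)` to `f(w) e`. -/
theorem eq_zero_of_orbitExt_eq_zero
    (hβ : Function.Bijective (TensorProduct.lift ((LinearMap.mul k A).compl₁₂ δ.toLinearMap j)))
    (he : e ≠ 0) {w : W} (hw : orbitExt δ e (j w) = 0) : w = 0 := by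
  rw [← Module.forall_dual_apply_eq_zero_iff k w]
  intro f
  let β := LinearEquiv.ofBijective _ hβ
  have hβ' (b : B) (w : W) : β (b ⊗ₜ w) = δ b * j w := by simp [β]
  have key : Abelian.Ext.mk₀ (orbitMap δ (j w) ≫ coordMap δ j β hβ' f) =
      f w • Abelian.Ext.mk₀ (𝟙 _) := by
    rw [← Abelian.Ext.mk₀_smul]
    congr 1
    refine ModuleCat.hom_ext (LinearMap.ext fun b => ?_)
    refine (congrArg (coordMap δ j β hβ' f).hom (hβ' b w).symm).trans
      ((coordMap_apply δ j β hβ' f b w).trans ?_)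
    exact Algebra.smul_def _ _
  have := congr(($hw).comp (Abelian.Ext.mk₀ (coordMap δ j β hβ' f)) (add_zero n))
  rw [orbitExt_apply, Abelian.Ext.comp_assoc_of_third_deg_zero, Abelian.Ext.mk₀_comp_mk₀, key,
    Abelian.Ext.comp_smul, Abelian.Ext.comp_mk₀_id, Abelian.Ext.zero_comp] at this
  exact (smul_eq_zero.1 this).resolve_right he

theorem orbitExt_injective
    (hβ : Function.Bijective (TensorProduct.lift ((LinearMap.mul k A).compl₁₂ δ.toLinearMap j)))
    (he : e ≠ 0) : Function.Injective fun w => orbitExt δ e (j w) := fun v w h =>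
  sub_eq_zero.1 (eq_zero_of_orbitExt_eq_zero δ hβ he (by
    rw [map_sub, map_sub]
    exact sub_eq_zero.2 h))

/-- For finitary `Ext`, the canonical map `Ext_B^n(X, B) ⊗ W → Ext_B^n(X, A)` is surjective: the
partial sums of the coordinate decomposition of the free module `A` eventually fix each element,
so one of them fixes `y`. -/
theorem IsFinitaryExt.exists_eq_sum_orbitExt (hX : IsFinitaryExt X n)
    (hβ : Function.Bijective (TensorProduct.lift ((LinearMap.mul k A).compl₁₂ δ.toLinearMap j)))
    (y : Abelian.Ext.{u} X ((res δ).obj (ModuleCat.of A A)) n) :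
    ∃ (ι : Type u) (s : Finset ι) (w : ι → W)
      (e : ι → Abelian.Ext.{u} X (ModuleCat.of B B) n),
      y = ∑ i ∈ s, orbitExt δ (e i) (j (w i)) := by
  let β := LinearEquiv.ofBijective _ hβ
  have hβ' (b : B) (w : W) : β (b ⊗ₜ w) = δ b * j w := by simp [β]
  let v := Module.Basis.ofVectorSpace k W
  let q (i : Module.Basis.ofVectorSpaceIndex k W) :=
    coordMap δ j β hβ' (v.coord i) ≫ orbitMap δ (j (v i))
  have hq (i) (b : B) (w : W) : (q i).hom (β (b ⊗ₜ w)) = δ b * j (v.coord i w • v i) := by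
    refine (congrArg (orbitMap δ (j (v i))).hom (coordMap_apply δ j β hβ' (v.coord i) b w)).trans ?_
    change δ (v.coord i w • b) * j (v i) = _
    simp
  obtain ⟨s, hs⟩ := hX _ _ (fun s => ∑ i ∈ s, q i) (fun a => by
    classical
    obtain ⟨t, rfl⟩ := β.surjective a
    induction t with
    | zero => exact ⟨∅, fun t _ => by rw [map_zero]; exact map_zero _⟩
    | add t t' h h' =>
      obtain ⟨s, hs⟩ := h
      obtain ⟨s', hs'⟩ := h'
      refine ⟨s ∪ s', fun r hr => ?_⟩
      rw [map_add]
      exact (map_add _ _ _).trans (congrArg₂ _ (hs r (Finset.union_subset_left hr))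
        (hs' r (Finset.union_subset_right hr)))
    | tmul b w =>
      refine ⟨(v.repr w).support, fun r hr => ?_⟩
      refine (ModuleCat.hom_finsetSum_apply q r _).trans ?_
      refine (Finset.sum_congr rfl fun i _ => hq i b w).trans ?_
      refine (Finset.mul_sum r (fun i => j (v.coord i w • v i)) (δ b)).symm.trans ?_
      rw [← map_sum, hβ']
      congr 2
      conv_rhs => rw [← v.linearCombination_repr w]
      rw [Finsupp.linearCombination_apply, Finsupp.sum_of_support_subset _ hr _ (by simp)]
      rfl) y
  refine ⟨_, s, v, fun i => y.comp (Abelian.Ext.mk₀ (coordMap δ j β hβ' (v.coord i))) (add_zero n),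
    ?_⟩
  conv_lhs => rw [← hs]
  simp only [orbitExt_apply, Abelian.Ext.comp_assoc_of_third_deg_zero, Abelian.Ext.mk₀_comp_mk₀]
  exact comp_mk₀_finsetSum y q s

theorem IsFinitaryExt.orbitExt_surjective (hX : IsFinitaryExt X n)
    (hβ : Function.Bijective (TensorProduct.lift ((LinearMap.mul k A).compl₁₂ δ.toLinearMap j)))
    (he : ∀ x, ∃ c : k, c • e = x) : Function.Surjective fun w => orbitExt δ e (j w) := by
  intro y
  obtain ⟨ι, s, w, e', rfl⟩ := hX.exists_eq_sum_orbitExt δ hβ y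
  choose c hc using fun i => he (e' i)
  refine ⟨∑ i ∈ s, c i • w i, ?_⟩
  simp only [map_sum, map_smul]
  refine Finset.sum_congr rfl fun i _ => ?_
  rw [← hc, orbitExt_apply, orbitExt_apply, Abelian.Ext.smul_comp]

/-- The factor `W` acts faithfully from the right on `Ext_A^n(E, A)` if this is not zero: restricted
to `B`, it contains a copy of `j(W)` for each nonzero class in `Ext_B^n(X, B)`. -/
theorem IsFinitaryExt.eq_zero_of_comp_rightMul_eq_zero (hX : IsFinitaryExt X n)
    (hβ : Function.Bijective (TensorProduct.lift ((LinearMap.mul k A).compl₁₂ δ.toLinearMap j)))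
    {E : ModuleCat.{u} A} {u : X ⟶ (res δ).obj E}
    (hu : Function.Bijective (resExt δ u (ModuleCat.of A A) n))
    {z : Abelian.Ext.{u} E (ModuleCat.of A A) n} (hz : z ≠ 0) {w : W}
    (hw : ∀ y : Abelian.Ext.{u} E (ModuleCat.of A A) n,
      y.comp (Abelian.Ext.mk₀ (rightMul (j w))) (add_zero n) = 0) : w = 0 := by
  have h0 : resExt δ u (ModuleCat.of A A) n 0 = 0 := by simp [resExt]
  -- `Ext_B^n(X, B)` and `W` generate the nonzero `Ext_A^n(E, A)`.
  obtain ⟨e, he⟩ : ∃ e : Abelian.Ext.{u} X (ModuleCat.of B B) n, e ≠ 0 := by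
    by_contra! hall
    obtain ⟨ι, s, v, e, h⟩ := hX.exists_eq_sum_orbitExt δ hβ (resExt δ u _ n z)
    refine hz (hu.1 (h.trans ?_))
    rw [h0]
    exact Finset.sum_eq_zero fun i _ => by rw [hall (e i), orbitExt_apply, Abelian.Ext.zero_comp]
  obtain ⟨y, hy⟩ := hu.2 (orbitExt δ e 1)
  refine eq_zero_of_orbitExt_eq_zero δ hβ he ?_
  rw [← one_mul (j w), ← orbitExt_comp_rightMul, ← hy, ← resExt_comp_mk₀, hw, h0]

end Coefficients

/-! ### The enveloping algebra of a Hopf algebra -/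

noncomputable section Envelope

variable (k H : Type u) [Field k] [Ring H] [HopfAlgebra k H]

/-- The enveloping algebra `H ⊗ Hᵒᵖ`; its modules are the `H`-bimodules. -/
abbrev Envelope : Type u := H ⊗[k] Hᵐᵒᵖ

/-- The map `h ↦ op (S h)`, whose convolution inverse is `h ↦ op (S² h)`. -/
def opAntipode : H →ₗ[k] Hᵐᵒᵖ := (MulOpposite.opLinearEquiv k).toLinearMap ∘ₗ antipode k (A := H)

/-- The map `h ↦ op (S² h)`. -/
def opAntipodeSq : H →ₗ[k] Hᵐᵒᵖ :=
  (MulOpposite.opLinearEquiv k).toLinearMap ∘ₗ antipode k (A := H) ∘ₗ antipode k (A := H)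

theorem opAntipode_mul_opAntipodeSq :
    toConv (opAntipode k H) * toConv (opAntipodeSq k H) = 1 := by
  ext a
  rw [(ℛ k a).convMul_apply]
  have := congr(MulOpposite.op (antipode k $(sum_mul_antipode_eq_algebraMap_counit (ℛ k a))))
  simpa [opAntipode, opAntipodeSq, antipode_mul_antidistrib,
    Algebra.algebraMap_eq_smul_one] using this

theorem opAntipodeSq_mul_opAntipode :
    toConv (opAntipodeSq k H) * toConv (opAntipode k H) = 1 := by
  ext a
  rw [(ℛ k a).convMul_apply]
  have := congr(MulOpposite.op (antipode k $(sum_antipode_mul_eq_algebraMap_counit (ℛ k a))))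
  simpa [opAntipode, opAntipodeSq, antipode_mul_antidistrib,
    Algebra.algebraMap_eq_smul_one] using this

/-- The algebra map `h ↦ h₁ ⊗ op (S h₂)`. Restriction along it takes a bimodule to the left module
with the adjoint action `h • m = h₁ m S(h₂)`. -/
def leftEmb : H →ₐ[k] Envelope k H :=
  (Algebra.TensorProduct.map (AlgHom.id k H) (antipodeAlgHomOp k H)).comp
    (Bialgebra.comulAlgHom k H)

/-- The algebra map `op h ↦ S h₁ ⊗ op h₂`. Restriction along it takes a bimodule to the right module
with the adjoint action `m • h = S(h₁) m h₂`. -/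
def rightEmb : Hᵐᵒᵖ →ₐ[k] Envelope k H :=
  AlgHom.ofLinearMap
    (TensorProduct.map (antipode k (A := H)) (MulOpposite.opLinearEquiv k).toLinearMap ∘ₗ comul ∘ₗ
      (MulOpposite.opLinearEquiv k).symm.toLinearMap)
    (by simp [Algebra.TensorProduct.one_def])
    (fun x y => by
      have key (p q : H ⊗[k] H) :
          TensorProduct.map (antipode k (A := H)) (MulOpposite.opLinearEquiv k).toLinearMap
              (q * p) =
            TensorProduct.map (antipode k (A := H)) (MulOpposite.opLinearEquiv k).toLinearMap p *
              TensorProduct.map (antipode k (A := H))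
                (MulOpposite.opLinearEquiv k).toLinearMap q := by
        induction p with
        | zero => simp
        | add p p' h h' => rw [mul_add, map_add, map_add, add_mul, h, h']
        | tmul a b =>
          induction q with
          | zero => simp
          | add q q' h h' => rw [add_mul, map_add, map_add, mul_add, h, h']
          | tmul a' b' => simp [antipode_mul_antidistrib]
      simp [key])

variable {k H}

theorem _root_.Coalgebra.sum_counit_smul' {ι : Type*} {h : H} (r : Coalgebra.Repr k h ι) :
    ∑ i ∈ r.index, counit (R := k) (r.right i) • r.left i = h := by
  have := congr(TensorProduct.rid k H $(Coalgebra.sum_tmul_counit_eq r))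
  rw [map_sum] at this
  simpa only [TensorProduct.rid_tmul, one_smul] using this

theorem leftEmb_apply (h : H) :
    leftEmb k H h = ∑ i ∈ (ℛ k h).index,
      (ℛ k h).left i ⊗ₜ[k] MulOpposite.op (antipode k ((ℛ k h).right i)) := by
  rw [leftEmb, AlgHom.comp_apply, Bialgebra.comulAlgHom_apply, ← (ℛ k h).eq]
  simp

theorem rightEmb_apply (x : Hᵐᵒᵖ) : rightEmb k H x =
    TensorProduct.map (antipode k (A := H)) (MulOpposite.opLinearEquiv k).toLinearMap
      (comul x.unop) :=
  rfl

theorem rightEmb_op (h : H) :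
    rightEmb k H (MulOpposite.op h) = ∑ i ∈ (ℛ k h).index,
      antipode k ((ℛ k h).left i) ⊗ₜ[k] MulOpposite.op ((ℛ k h).right i) := by
  rw [rightEmb_apply, MulOpposite.unop_op, ← (ℛ k h).eq]
  simp

variable (k H) in
/-- The linear map `w ↦ 1 ⊗ op w`, a complement to `leftEmb`. -/
def rightFactor : H →ₗ[k] Envelope k H :=
  Algebra.TensorProduct.includeRight.toLinearMap ∘ₗ (MulOpposite.opLinearEquiv k).toLinearMap

variable (k H) in
/-- The linear map `w ↦ w ⊗ 1`, a complement to `rightEmb`. -/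
def leftFactor : H →ₗ[k] Envelope k H :=
  (Algebra.TensorProduct.includeLeft (R := k) (S := k)).toLinearMap

@[simp]
theorem rightFactor_apply (w : H) : rightFactor k H w = 1 ⊗ₜ MulOpposite.op w := rfl

@[simp]
theorem leftFactor_apply (w : H) : leftFactor k H w = w ⊗ₜ 1 := rfl

theorem leftEmb_mul (h : H) (y : Hᵐᵒᵖ) :
    leftEmb k H h * (1 ⊗ₜ y) = twistRight (opAntipode k H) (h ⊗ₜ y) := by
  rw [leftEmb_apply, twistRight_tmul, Finset.sum_mul]
  simp [opAntipode]

theorem mul_leftEmb (h w : H) :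
    rightFactor k H w * leftEmb k H h =
      TensorProduct.congr (LinearEquiv.refl k H) (MulOpposite.opLinearEquiv k)
        (twistRight (antipode k (A := H)) (h ⊗ₜ w)) := by
  rw [leftEmb_apply, twistRight_tmul, Finset.mul_sum, map_sum]
  simp

theorem rightEmb_mul (h w : H) :
    rightEmb k H (MulOpposite.op h) * leftFactor k H w =
      TensorProduct.congr (MulOpposite.opLinearEquiv k (M := H)).symm (MulOpposite.opLinearEquiv k)
        (twistLeft (opAntipode k H) (MulOpposite.op w ⊗ₜ h)) := by
  rw [rightEmb_op, twistLeft_tmul, Finset.sum_mul, map_sum]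
  simp [opAntipode]

theorem mul_rightEmb (h w : H) :
    leftFactor k H w * rightEmb k H (MulOpposite.op h) =
      TensorProduct.congr (LinearEquiv.refl k H) (MulOpposite.opLinearEquiv k)
        (twistLeft (antipode k (A := H)) (w ⊗ₜ h)) := by
  rw [rightEmb_op, twistLeft_tmul, Finset.mul_sum, map_sum]
  simp

/-- The enveloping algebra is free as a left `H`-module via `leftEmb`: the factorization is the
twist by `op ∘ S`, which is convolution invertible even when `S` is not bijective. -/
theorem leftEmb_rightFactor_bijective :
    Function.Bijective (TensorProduct.lift
      ((LinearMap.mul k (Envelope k H)).compl₁₂ (leftEmb k H).toLinearMap (rightFactor k H))) := by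
  have : TensorProduct.lift
      ((LinearMap.mul k (Envelope k H)).compl₁₂ (leftEmb k H).toLinearMap (rightFactor k H)) =
      twistRight (opAntipode k H) ∘ₗ
        (TensorProduct.congr (LinearEquiv.refl k H)
          (MulOpposite.opLinearEquiv k (M := H))).toLinearMap := by
    ext h w
    simp [← leftEmb_mul]
  rw [this]
  exact (twistRight_bijective (opAntipode_mul_opAntipodeSq k H)
    (opAntipodeSq_mul_opAntipode k H)).comp (LinearEquiv.bijective _)

/-- The enveloping algebra is free as a right `H`-module via `leftEmb`. -/
theorem rightFactor_leftEmb_bijective :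
    Function.Bijective (TensorProduct.lift
      ((LinearMap.mul k (Envelope k H)).compl₁₂ (rightFactor k H) (leftEmb k H).toLinearMap)) := by
  have : TensorProduct.lift
      ((LinearMap.mul k (Envelope k H)).compl₁₂ (rightFactor k H) (leftEmb k H).toLinearMap) =
      (TensorProduct.congr (LinearEquiv.refl k H)
        (MulOpposite.opLinearEquiv k (M := H))).toLinearMap ∘ₗ
        twistRight (antipode k (A := H)) ∘ₗ (TensorProduct.comm k H H).toLinearMap := by
    ext w h
    exact mul_leftEmb h w
  rw [this]
  rw [LinearMap.coe_comp, LinearMap.coe_comp]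
  refine Function.Bijective.comp ?_ ((twistRight_bijective LinearMap.antipode_mul_id
    LinearMap.id_mul_antipode).comp ?_)
  · exact LinearEquiv.bijective _
  · exact LinearEquiv.bijective _

/-- The enveloping algebra is free as a left `Hᵐᵒᵖ`-module via `rightEmb`. -/
theorem rightEmb_leftFactor_bijective :
    Function.Bijective (TensorProduct.lift
      ((LinearMap.mul k (Envelope k H)).compl₁₂ (rightEmb k H).toLinearMap (leftFactor k H))) := by
  have : TensorProduct.lift
      ((LinearMap.mul k (Envelope k H)).compl₁₂ (rightEmb k H).toLinearMap (leftFactor k H)) =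
      (TensorProduct.congr (MulOpposite.opLinearEquiv k (M := H)).symm
        (MulOpposite.opLinearEquiv k (M := H))).toLinearMap ∘ₗ twistLeft (opAntipode k H) ∘ₗ
          (TensorProduct.comm k H Hᵐᵒᵖ).toLinearMap ∘ₗ
          (TensorProduct.congr (MulOpposite.opLinearEquiv k (M := H)).symm
            (MulOpposite.opLinearEquiv k (M := H))).toLinearMap := by
    ext h w
    exact rightEmb_mul h.unop w
  rw [this]
  rw [LinearMap.coe_comp, LinearMap.coe_comp, LinearMap.coe_comp]
  refine Function.Bijective.comp ?_ ((twistLeft_bijective (opAntipode_mul_opAntipodeSq k H)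
    (opAntipodeSq_mul_opAntipode k H)).comp (Function.Bijective.comp ?_ ?_))
  · exact LinearEquiv.bijective _
  · exact LinearEquiv.bijective _
  · exact LinearEquiv.bijective _

/-- The enveloping algebra is free as a right `Hᵐᵒᵖ`-module via `rightEmb`. -/
theorem leftFactor_rightEmb_bijective :
    Function.Bijective (TensorProduct.lift
      ((LinearMap.mul k (Envelope k H)).compl₁₂ (leftFactor k H) (rightEmb k H).toLinearMap)) := by
  have : TensorProduct.lift
      ((LinearMap.mul k (Envelope k H)).compl₁₂ (leftFactor k H) (rightEmb k H).toLinearMap) =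
      (TensorProduct.congr (LinearEquiv.refl k H)
        (MulOpposite.opLinearEquiv k (M := H))).toLinearMap ∘ₗ
        twistLeft (antipode k (A := H)) ∘ₗ
        (TensorProduct.congr (LinearEquiv.refl k H)
          (MulOpposite.opLinearEquiv k (M := H)).symm).toLinearMap := by
    ext w h
    exact mul_rightEmb h.unop w
  rw [this]
  rw [LinearMap.coe_comp, LinearMap.coe_comp]
  refine Function.Bijective.comp ?_ ((twistLeft_bijective LinearMap.antipode_mul_id
    LinearMap.id_mul_antipode).comp ?_)
  · exact LinearEquiv.bijective _
  · exact LinearEquiv.bijective _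

theorem sum_rightFactor_mul_leftEmb (h : H) :
    ∑ i ∈ (ℛ k h).index, rightFactor k H ((ℛ k h).right i) * leftEmb k H ((ℛ k h).left i) =
      h ⊗ₜ 1 := by
  have h1 : twistRight (antipode k (A := H)) (twistRight LinearMap.id (h ⊗ₜ[k] (1 : H))) =
      h ⊗ₜ 1 := by
    have := congr($(twistRight_comp (antipode k (A := H)) LinearMap.id) (h ⊗ₜ[k] (1 : H)))
    rwa [LinearMap.antipode_mul_id, twistRight_one] at this
  simp only [mul_leftEmb]
  rw [twistRight_tmul LinearMap.id] at h1
  simp only [LinearMap.id_apply, mul_one] at h1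
  rw [← map_sum, ← map_sum, h1]
  simp

theorem sum_leftFactor_mul_rightEmb (h : H) :
    ∑ i ∈ (ℛ k h).index, leftFactor k H ((ℛ k h).left i) *
      rightEmb k H (MulOpposite.op ((ℛ k h).right i)) = 1 ⊗ₜ MulOpposite.op h := by
  have h1 : twistLeft (antipode k (A := H)) (twistLeft LinearMap.id ((1 : H) ⊗ₜ[k] h)) =
      1 ⊗ₜ h := by
    have := congr($(twistLeft_comp (antipode k (A := H)) LinearMap.id) ((1 : H) ⊗ₜ[k] h))
    rwa [LinearMap.id_mul_antipode, twistLeft_one] at this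
  simp only [mul_rightEmb]
  rw [twistLeft_tmul LinearMap.id] at h1
  simp only [LinearMap.id_apply, one_mul] at h1
  rw [← map_sum, ← map_sum, h1]
  simp

/-- The right action of the enveloping algebra in terms of the left factorization. This is where
`S²` comes from: it inverts the `S` of `leftEmb` in the convolution algebra of maps to `Hᵐᵒᵖ`. -/
theorem rightFactor_mul_tmul (w c d : H) :
    rightFactor k H w * (c ⊗ₜ MulOpposite.op d) = ∑ i ∈ (ℛ k c).index,
      leftEmb k H ((ℛ k c).left i) *
        rightFactor k H (d * w * antipode k (antipode k ((ℛ k c).right i))) := by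
  have h1 : twistRight (opAntipode k H) (twistRight (opAntipodeSq k H)
      (c ⊗ₜ[k] MulOpposite.op (d * w))) = c ⊗ₜ MulOpposite.op (d * w) := by
    have := congr($(twistRight_comp (opAntipode k H) (opAntipodeSq k H))
      (c ⊗ₜ[k] MulOpposite.op (d * w)))
    rwa [opAntipode_mul_opAntipodeSq, twistRight_one] at this
  simp only [rightFactor_apply, leftEmb_mul]
  rw [twistRight_tmul (opAntipodeSq k H), map_sum] at h1
  simpa [opAntipodeSq] using h1.symm

theorem leftFactor_mul_tmul (w c d : H) :
    leftFactor k H w * (c ⊗ₜ MulOpposite.op d) = ∑ i ∈ (ℛ k d).index,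
      rightEmb k H (MulOpposite.op ((ℛ k d).right i)) *
        leftFactor k H (antipode k (antipode k ((ℛ k d).left i)) * w * c) := by
  have h1 : twistLeft (opAntipode k H) (twistLeft (opAntipodeSq k H)
      (MulOpposite.op (w * c) ⊗ₜ[k] d)) = MulOpposite.op (w * c) ⊗ₜ d := by
    have := congr($(twistLeft_comp (opAntipode k H) (opAntipodeSq k H))
      (MulOpposite.op (w * c) ⊗ₜ[k] d))
    rwa [opAntipodeSq_mul_opAntipode, twistLeft_one] at this
  simp only [rightEmb_mul]
  rw [twistLeft_tmul (opAntipodeSq k H), map_sum] at h1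
  rw [← map_sum]
  simp only [opAntipodeSq, LinearMap.comp_apply, LinearEquiv.coe_coe, MulOpposite.coe_opLinearEquiv,
    ← MulOpposite.op_mul, ← mul_assoc] at h1
  rw [h1]
  simp

/-! ### The regular bimodule -/

-- The instance makes an `H`-bimodule, given by commuting actions of `H` and `Hᵐᵒᵖ`, a module over
-- `H ⊗ Hᵐᵒᵖ`.
attribute [local instance] TensorProduct.Algebra.module

variable (k H) in
/-- `H` as an `H`-bimodule, in the form of a module over the enveloping algebra. -/
abbrev regularBimodule : ModuleCat.{u} (Envelope k H) := ModuleCat.of (Envelope k H) H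

theorem tmul_smul_regular (a : H) (b : Hᵐᵒᵖ) (x : H) :
    (a ⊗ₜ[k] b : Envelope k H) • x = a * x * b.unop := by
  rw [TensorProduct.Algebra.smul_def, smul_eq_mul, MulOpposite.smul_eq_mul_unop, mul_assoc]

theorem leftEmb_smul_algebraMap (h : H) (c : k) :
    leftEmb k H h • algebraMap k H c = algebraMap k H (counit h * c) := by
  rw [leftEmb_apply, Finset.sum_smul, map_mul,
    ← sum_mul_antipode_eq_algebraMap_counit (ℛ k h), Finset.sum_mul]
  simp only [tmul_smul_regular, MulOpposite.unop_op]
  exact Finset.sum_congr rfl fun i _ => by rw [← Algebra.commutes, mul_assoc, Algebra.commutes]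

theorem rightEmb_smul_algebraMap (h : H) (c : k) :
    rightEmb k H (MulOpposite.op h) • algebraMap k H c = algebraMap k H (counit h * c) := by
  rw [rightEmb_op, Finset.sum_smul, map_mul,
    ← sum_antipode_mul_eq_algebraMap_counit (ℛ k h), Finset.sum_mul]
  simp only [tmul_smul_regular, MulOpposite.unop_op]
  exact Finset.sum_congr rfl fun i _ => by rw [← Algebra.commutes, mul_assoc, Algebra.commutes]

variable (k H) in
/-- The unit `k → H`, linear for the adjoint action `h • x = h₁ x S(h₂)`. -/
def leftUnit : leftTrivial k H ⟶ (res (leftEmb k H)).obj (regularBimodule k H) :=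
  ModuleCat.ofHom (X := leftTrivial k H) (Y := (res (leftEmb k H)).obj (regularBimodule k H))
    { toFun := fun (c : k) => algebraMap k H c
      map_add' := fun (c c' : k) => map_add (algebraMap k H) c c'
      map_smul' := fun h (c : k) => (leftEmb_smul_algebraMap h c).symm }

variable (k H) in
/-- The unit `k → H`, linear for the adjoint action `x • h = S(h₁) x h₂`. -/
def rightUnit : rightTrivial k H ⟶ (res (rightEmb k H)).obj (regularBimodule k H) :=
  ModuleCat.ofHom (X := rightTrivial k H) (Y := (res (rightEmb k H)).obj (regularBimodule k H))
    { toFun := fun (c : k) => algebraMap k H c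
      map_add' := fun (c c' : k) => map_add (algebraMap k H) c c'
      map_smul' := fun h (c : k) => (rightEmb_smul_algebraMap h.unop c).symm }

/-- An element of a bimodule is central if the two actions of `H` on it agree. -/
def IsCentral {M : ModuleCat.{u} (Envelope k H)} (m : M) : Prop :=
  ∀ h : H, (h ⊗ₜ[k] 1 : Envelope k H) • m = (1 ⊗ₜ[k] MulOpposite.op h : Envelope k H) • m

/-- The bimodule map `x ↦ x m` given by a central element. -/
def centralHom {M : ModuleCat.{u} (Envelope k H)} (m : M) (hm : IsCentral m) :
    regularBimodule k H ⟶ M :=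
  ModuleCat.ofHom (X := H)
    { toFun := fun x => leftFactor k H x • m
      map_add' := fun x y => by rw [map_add, add_smul]
      map_smul' := fun a x => by
        rw [RingHom.id_apply]
        induction a using TensorProduct.induction_on with
        | zero =>
          refine (congrArg (fun y => leftFactor k H y • m) (zero_smul (Envelope k H) x)).trans ?_
          rw [map_zero]
          exact (zero_smul (Envelope k H) m).trans
            (zero_smul (Envelope k H) (leftFactor k H x • m)).symm
        | add a a' h h' => rw [add_smul, map_add, add_smul, h, h', add_smul]
        | tmul a b =>
          have h1 : ((a * x * b.unop) ⊗ₜ[k] 1 : Envelope k H) =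
            ((a * x) ⊗ₜ[k] 1 : Envelope k H) * (b.unop ⊗ₜ[k] 1) := by simp
          rw [tmul_smul_regular, leftFactor_apply, h1, mul_smul, hm, ← mul_smul,
            leftFactor_apply, ← mul_smul]
          simp }

theorem regularBimodule_hom_ext {M : ModuleCat.{u} (Envelope k H)} {f g : regularBimodule k H ⟶ M}
    (h : f.hom (1 : H) = g.hom (1 : H)) : f = g := by
  refine ModuleCat.hom_ext (LinearMap.ext fun (x : H) => ?_)
  have hx : (x ⊗ₜ[k] 1 : Envelope k H) • (1 : H) = x := by simp [tmul_smul_regular]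
  rw [← hx, map_smul, map_smul, h]

theorem leftTrivial_smul_apply_one {N : ModuleCat.{u} H} (g : leftTrivial k H ⟶ N) (h : H) :
    h • g.hom (1 : k) = g.hom (counit h : k) :=
  (g.hom.map_smul h (1 : k)).symm.trans (congrArg g.hom (mul_one (counit h : k)))

theorem leftTrivial_apply {N : ModuleCat.{u} H} (g : leftTrivial k H ⟶ N) (c : k) :
    g.hom c = algebraMap k H c • g.hom (1 : k) := by
  rw [leftTrivial_smul_apply_one, Bialgebra.counit_algebraMap]

theorem rightTrivial_smul_apply_one {N : ModuleCat.{u} Hᵐᵒᵖ} (g : rightTrivial k H ⟶ N) (h : H) :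
    MulOpposite.op h • g.hom (1 : k) = g.hom (counit h : k) :=
  (g.hom.map_smul (MulOpposite.op h) (1 : k)).symm.trans
    (congrArg g.hom (mul_one (counit h : k)))

theorem rightTrivial_apply {N : ModuleCat.{u} Hᵐᵒᵖ} (g : rightTrivial k H ⟶ N) (c : k) :
    g.hom c = algebraMap k Hᵐᵒᵖ c • g.hom (1 : k) := by
  rw [MulOpposite.algebraMap_apply, rightTrivial_smul_apply_one, Bialgebra.counit_algebraMap]

/-- Invariants for the adjoint action `h₁ m S(h₂)` are central, since `h m = (h₁ m S(h₂)) h₃`. -/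
theorem isCentral_of_leftEmb {M : ModuleCat.{u} (Envelope k H)} {m : M}
    (hm : ∀ h : H, leftEmb k H h • m = algebraMap k (Envelope k H) (counit h) • m) :
    IsCentral m := fun h => by
  have h1 : ∑ i ∈ (ℛ k h).index, rightFactor k H ((ℛ k h).right i) *
      algebraMap k (Envelope k H) (counit ((ℛ k h).left i)) = rightFactor k H h := by
    conv_rhs => rw [← Coalgebra.sum_counit_smul (ℛ k h), map_sum]
    refine Finset.sum_congr rfl fun i _ => ?_
    rw [← Algebra.commutes, ← Algebra.smul_def, ← map_smul]
  rw [← sum_rightFactor_mul_leftEmb h, Finset.sum_smul, ← rightFactor_apply, ← h1,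
    Finset.sum_smul]
  simp only [mul_smul, hm]

/-- Invariants for the adjoint action `S(h₁) m h₂` are central, since `m h = h₁ (S(h₂) m h₃)`. -/
theorem isCentral_of_rightEmb {M : ModuleCat.{u} (Envelope k H)} {m : M}
    (hm : ∀ h : H, rightEmb k H (MulOpposite.op h) • m =
      algebraMap k (Envelope k H) (counit h) • m) :
    IsCentral m := fun h => by
  have h1 : ∑ i ∈ (ℛ k h).index, leftFactor k H ((ℛ k h).left i) *
      algebraMap k (Envelope k H) (counit ((ℛ k h).right i)) = leftFactor k H h := by
    conv_rhs => rw [← Coalgebra.sum_counit_smul' (ℛ k h), map_sum]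
    refine Finset.sum_congr rfl fun i _ => ?_
    rw [← Algebra.commutes, ← Algebra.smul_def, ← map_smul]
  rw [← sum_leftFactor_mul_rightEmb h, Finset.sum_smul, ← leftFactor_apply, ← h1,
    Finset.sum_smul]
  simp only [mul_smul, hm]

/-- The regular bimodule is induced from the trivial left module along `leftEmb`. -/
theorem leftUnit_bijective (M : ModuleCat.{u} (Envelope k H)) :
    Function.Bijective fun f : regularBimodule k H ⟶ M =>
      leftUnit k H ≫ (res (leftEmb k H)).map f := by
  constructor
  · intro f g hfg
    apply regularBimodule_hom_ext
    have : f.hom (algebraMap k H 1) = g.hom (algebraMap k H 1) := congr(($hfg).hom (1 : k))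
    simpa using this
  · intro g
    have hg (c : k) : g.hom c = algebraMap k (Envelope k H) c • (show M from g.hom (1 : k)) := by
      rw [leftTrivial_apply, ← AlgHom.commutes (leftEmb k H)]
      rfl
    refine ⟨centralHom (g.hom (1 : k)) (isCentral_of_leftEmb fun h => ?_),
      ModuleCat.hom_ext (LinearMap.ext fun (c : k) => (hg c).symm)⟩
    exact (leftTrivial_smul_apply_one g h).trans (hg _)

/-- The regular bimodule is induced from the trivial right module along `rightEmb`. -/
theorem rightUnit_bijective (M : ModuleCat.{u} (Envelope k H)) :
    Function.Bijective fun f : regularBimodule k H ⟶ M =>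
      rightUnit k H ≫ (res (rightEmb k H)).map f := by
  constructor
  · intro f g hfg
    apply regularBimodule_hom_ext
    have : f.hom (algebraMap k H 1) = g.hom (algebraMap k H 1) := congr(($hfg).hom (1 : k))
    simpa using this
  · intro g
    have hg (c : k) : g.hom c = algebraMap k (Envelope k H) c • (show M from g.hom (1 : k)) := by
      rw [rightTrivial_apply, ← AlgHom.commutes (rightEmb k H)]
      rfl
    refine ⟨centralHom (g.hom (1 : k)) (isCentral_of_rightEmb fun h => ?_),
      ModuleCat.hom_ext (LinearMap.ext fun (c : k) => (hg c).symm)⟩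
    exact (rightTrivial_smul_apply_one g h).trans (hg _)

variable (k H) in
/-- The algebra map `a ⊗ op b ↦ ε(b) a`, a retraction of `leftEmb`. -/
def leftAug : Envelope k H →ₐ[k] H :=
  AlgHom.ofLinearMap
    ((TensorProduct.rid k H).toLinearMap ∘ₗ LinearMap.lTensor H
      (counit ∘ₗ (MulOpposite.opLinearEquiv k).symm.toLinearMap))
    (by simp [Algebra.TensorProduct.one_def])
    (fun x y => by
      induction x using TensorProduct.induction_on with
      | zero => simp
      | add x x' h h' => rw [add_mul, map_add, map_add, add_mul, h, h']
      | tmul a b =>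
        induction y using TensorProduct.induction_on with
        | zero => simp
        | add y y' h h' => rw [mul_add, map_add, map_add, mul_add, h, h']
        | tmul a' b' => simp [smul_smul, mul_comm])

variable (k H) in
/-- The algebra map `a ⊗ b ↦ ε(a) b`, a retraction of `rightEmb`. -/
def rightAug : Envelope k H →ₐ[k] Hᵐᵒᵖ :=
  (Algebra.TensorProduct.lid k Hᵐᵒᵖ).toAlgHom.comp
    (Algebra.TensorProduct.map (Bialgebra.counitAlgHom k H) (AlgHom.id k Hᵐᵒᵖ))

theorem leftAug_leftEmb (h : H) : leftAug k H (leftEmb k H h) = h := by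
  rw [leftEmb_apply, map_sum]
  simp [leftAug, Coalgebra.sum_counit_smul']

theorem rightAug_rightEmb (h : Hᵐᵒᵖ) : rightAug k H (rightEmb k H h) = h := by
  obtain ⟨h, rfl⟩ := MulOpposite.op_surjective h
  rw [rightEmb_op, map_sum]
  simp only [rightAug, AlgHom.comp_apply, Algebra.TensorProduct.map_tmul]
  refine Eq.trans ?_ (congrArg (MulOpposite.opLinearEquiv k) (Coalgebra.sum_counit_smul (ℛ k h)))
  rw [map_sum]
  simp

end Envelope

/-! ### One-dimensional `Ext` groups and their characters -/

noncomputable section Final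

/-- An action on a one-dimensional space, left or right, is by a character: as scalars commute, the
order of the factors in `T (a * b)` does not matter. -/
theorem exists_algHom_of_finrank_eq_one {k H V : Type*} [Field k] [Ring H] [Algebra k H]
    [AddCommGroup V] [Module k V] (hV : Module.finrank k V = 1) (T : H →ₗ[k] Module.End k V)
    (h1 : T 1 = 1) (hmul : ∀ a b, T (a * b) = T a * T b ∨ T (a * b) = T b * T a) :
    ∃ χ : H →ₐ[k] k, ∀ a v, T a v = χ a • v := by
  obtain ⟨e, he, hspan⟩ := finrank_eq_one_iff'.1 hV
  choose χ hχ using fun a => hspan (T a e)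
  have hinj {c d : k} (h : c • e = d • e) : c = d := smul_left_injective k he h
  have hT (a : H) (v : V) : T a v = χ a • v := by
    obtain ⟨c, rfl⟩ := hspan v
    rw [map_smul, ← hχ, smul_comm]
  refine ⟨AlgHom.ofLinearMap
    { toFun := χ
      map_add' := fun a b => hinj ?_
      map_smul' := fun c a => hinj ?_ } (hinj ?_) (fun a b => hinj ?_), hT⟩
  · rw [← hT, map_add, LinearMap.add_apply, hT, hT, add_smul]
  · rw [← hT, map_smul, LinearMap.smul_apply, hT, RingHom.id_apply, smul_assoc]
  · change χ 1 • e = _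
    rw [← hT, h1, Module.End.one_apply, one_smul]
  · change χ (a * b) • e = (χ a * χ b) • e
    rw [← hT]
    rcases hmul a b with h | h <;> rw [h, Module.End.mul_apply, hT, hT, smul_smul]
    rw [mul_comm]

variable {k H : Type u} [Field k] [Ring H] [HopfAlgebra k H]

section Characters

variable {i : ℕ}

theorem exists_char_rightAct (h : Module.finrank k (LeftExt k H i) = 1) :
    ∃ ξ : H →ₐ[k] k, ∀ (x : LeftExt k H i) (b : H), rightAct x b = ξ b • x := by
  let r (b : H) : ModuleCat.of H H ⟶ ModuleCat.of H H :=
    ModuleCat.ofHom (DistribSMul.toLinearMap H H (MulOpposite.op b))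
  have r_add (a b : H) : r (a + b) = r a + r b :=
    ModuleCat.hom_ext (LinearMap.ext fun x => mul_add x a b)
  let T : H →ₗ[k] Module.End k (LeftExt k H i) := LinearMap.mk₂ k (fun b x => rightAct x b)
    (fun a b x => by
      change x.comp (Abelian.Ext.mk₀ (r (a + b))) _ = _
      rw [r_add, Abelian.Ext.mk₀_add, Abelian.Ext.comp_add]; rfl)
    (fun c b x => by
      change x.comp (Abelian.Ext.mk₀ (r (c • b))) _ = _
      change _ = c • x.comp (Abelian.Ext.mk₀ (r b)) (add_zero i)
      rw [← Abelian.Ext.comp_smul, ← Abelian.Ext.mk₀_smul]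
      congr 2
      exact ModuleCat.hom_ext (LinearMap.ext fun (x : H) =>
        (mul_smul_comm c x b).trans (Algebra.smul_def c (x * b))))
    (fun b x y => Abelian.Ext.add_comp _ _ _ _)
    (fun c b x => Abelian.Ext.smul_comp _ _ _ _)
  have hT (b : H) (x : LeftExt k H i) : T b x = x.comp (Abelian.Ext.mk₀ (r b)) (add_zero i) := rfl
  obtain ⟨ξ, hξ⟩ := exists_algHom_of_finrank_eq_one h T
    (LinearMap.ext fun x => by
      have : r 1 = 𝟙 _ := ModuleCat.hom_ext (LinearMap.ext fun x => mul_one x)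
      rw [hT, this, Abelian.Ext.comp_mk₀_id, Module.End.one_apply])
    (fun a b => Or.inr (LinearMap.ext fun x => by
      have : r (a * b) = r a ≫ r b :=
        ModuleCat.hom_ext (LinearMap.ext fun x => (mul_assoc x a b).symm)
      rw [Module.End.mul_apply, hT, hT, hT, this, Abelian.Ext.comp_assoc_of_third_deg_zero,
        Abelian.Ext.mk₀_comp_mk₀]))
  exact ⟨ξ, fun x b => hξ b x⟩

theorem exists_char_leftAct (h : Module.finrank k (RightExt k H i) = 1) :
    ∃ η : H →ₐ[k] k, ∀ (b : H) (x : RightExt k H i), leftAct b x = η b • x := by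
  let r (b : H) : ModuleCat.of Hᵐᵒᵖ H ⟶ ModuleCat.of Hᵐᵒᵖ H :=
    ModuleCat.ofHom (DistribSMul.toLinearMap Hᵐᵒᵖ H b)
  have r_add (a b : H) : r (a + b) = r a + r b :=
    ModuleCat.hom_ext (LinearMap.ext fun x => add_mul a b x)
  let T : H →ₗ[k] Module.End k (RightExt k H i) := LinearMap.mk₂ k (fun b x => leftAct b x)
    (fun a b x => by
      change x.comp (Abelian.Ext.mk₀ (r (a + b))) _ = _
      rw [r_add, Abelian.Ext.mk₀_add, Abelian.Ext.comp_add]; rfl)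
    (fun c b x => by
      change x.comp (Abelian.Ext.mk₀ (r (c • b))) _ = _
      change _ = c • x.comp (Abelian.Ext.mk₀ (r b)) (add_zero i)
      rw [← Abelian.Ext.comp_smul, ← Abelian.Ext.mk₀_smul]
      congr 2
      refine ModuleCat.hom_ext (LinearMap.ext fun (x : H) => ?_)
      change (c • b) * x = (b * x) * algebraMap k H c
      rw [smul_mul_assoc, ← Algebra.commutes, Algebra.smul_def])
    (fun b x y => Abelian.Ext.add_comp _ _ _ _)
    (fun c b x => Abelian.Ext.smul_comp _ _ _ _)
  have hT (b : H) (x : RightExt k H i) : T b x = x.comp (Abelian.Ext.mk₀ (r b)) (add_zero i) := rfl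
  obtain ⟨η, hη⟩ := exists_algHom_of_finrank_eq_one h T
    (LinearMap.ext fun x => by
      have : r 1 = 𝟙 _ := ModuleCat.hom_ext (LinearMap.ext fun x => one_mul x)
      rw [hT, this, Abelian.Ext.comp_mk₀_id, Module.End.one_apply])
    (fun a b => Or.inl (LinearMap.ext fun x => by
      have : r (a * b) = r b ≫ r a :=
        ModuleCat.hom_ext (LinearMap.ext fun x => mul_assoc a b x)
      rw [Module.End.mul_apply, hT, hT, hT, this, Abelian.Ext.comp_assoc_of_third_deg_zero,
        Abelian.Ext.mk₀_comp_mk₀]))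
  exact ⟨η, fun b x => hη b x⟩

/-- A generator of a one-dimensional `Ext^n(X, B)` on which `B` acts from the right by `χ`. -/
structure IsCharGenerator {B : Type u} [Ring B] [Algebra k B] {X : ModuleCat.{u} B} {n : ℕ}
    (e : Abelian.Ext.{u} X (ModuleCat.of B B) n) (χ : B → k) : Prop where
  ne_zero : e ≠ 0
  span : ∀ x, ∃ c : k, c • e = x
  act : ∀ b, e.comp (Abelian.Ext.mk₀ (rightMul b)) (add_zero n) = χ b • e

theorem exists_isCharGenerator_left (h : Module.finrank k (LeftExt k H i) = 1) (ξ : H →ₐ[k] k)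
    (hξ : ∀ (x : LeftExt k H i) (b : H), rightAct x b = ξ b • x) :
    ∃ e : LeftExt k H i, IsCharGenerator e ξ := by
  obtain ⟨e, he, hspan⟩ := finrank_eq_one_iff'.1 h
  exact ⟨e, he, hspan, fun b => hξ e b⟩

/-- The `Hᵐᵒᵖ`-module `H` of coefficients is replaced by the isomorphic regular module `Hᵐᵒᵖ`, which
turns `leftAct` into `rightMul`. -/
theorem exists_isCharGenerator_right (h : Module.finrank k (RightExt k H i) = 1) (η : H →ₐ[k] k)
    (hη : ∀ (b : H) (x : RightExt k H i), leftAct b x = η b • x) :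
    ∃ e : Abelian.Ext.{u} (rightTrivial k H) (ModuleCat.of Hᵐᵒᵖ Hᵐᵒᵖ) i,
      IsCharGenerator e fun b => η b.unop := by
  obtain ⟨e, he, hspan⟩ := finrank_eq_one_iff'.1 h
  let κ : ModuleCat.of Hᵐᵒᵖ H ⟶ ModuleCat.of Hᵐᵒᵖ Hᵐᵒᵖ := ModuleCat.ofHom
    { toFun := MulOpposite.op, map_add' := fun _ _ => rfl, map_smul' := fun _ _ => rfl }
  let κ' : ModuleCat.of Hᵐᵒᵖ Hᵐᵒᵖ ⟶ ModuleCat.of Hᵐᵒᵖ H := ModuleCat.ofHom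
    { toFun := MulOpposite.unop, map_add' := fun _ _ => rfl, map_smul' := fun _ _ => rfl }
  have h1 (x : RightExt k H i) : (x.comp (Abelian.Ext.mk₀ κ) (add_zero i)).comp
      (Abelian.Ext.mk₀ κ') (add_zero i) = x := by
    rw [Abelian.Ext.comp_assoc_of_third_deg_zero, Abelian.Ext.mk₀_comp_mk₀]
    exact Abelian.Ext.comp_mk₀_id x
  have h2 (x : Abelian.Ext.{u} (rightTrivial k H) (ModuleCat.of Hᵐᵒᵖ Hᵐᵒᵖ) i) :
      (x.comp (Abelian.Ext.mk₀ κ') (add_zero i)).comp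
      (Abelian.Ext.mk₀ κ) (add_zero i) = x := by
    rw [Abelian.Ext.comp_assoc_of_third_deg_zero, Abelian.Ext.mk₀_comp_mk₀]
    exact Abelian.Ext.comp_mk₀_id x
  refine ⟨e.comp (Abelian.Ext.mk₀ κ) (add_zero i), fun h0 => he ?_, fun x => ?_, fun b => ?_⟩
  · rw [← h1 e, h0, Abelian.Ext.zero_comp]
  · obtain ⟨c, hc⟩ := hspan (x.comp (Abelian.Ext.mk₀ κ') (add_zero i))
    exact ⟨c, by rw [← Abelian.Ext.smul_comp, hc, h2]⟩
  · have := congr(($(hη b.unop e)).comp (Abelian.Ext.mk₀ κ) (add_zero i))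
    rw [Abelian.Ext.smul_comp] at this
    rw [← this, leftAct, Abelian.Ext.comp_assoc_of_third_deg_zero, Abelian.Ext.mk₀_comp_mk₀,
      Abelian.Ext.comp_assoc_of_third_deg_zero, Abelian.Ext.mk₀_comp_mk₀]
    rfl

end Characters

/-! ### `Ext` of the regular bimodule, computed from either side -/

theorem resExt_leftUnit_bijective (n : ℕ) (M : ModuleCat.{u} (Envelope k H)) :
    Function.Bijective (resExt (leftEmb k H) (leftUnit k H) M n) :=
  resExt_bijective _ _ _ rightFactor_leftEmb_bijective leftUnit_bijective n M

theorem resExt_rightUnit_bijective (n : ℕ) (M : ModuleCat.{u} (Envelope k H)) :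
    Function.Bijective (resExt (rightEmb k H) (rightUnit k H) M n) :=
  resExt_bijective _ _ _ leftFactor_rightEmb_bijective rightUnit_bijective n M

theorem isFinitaryExt_leftTrivial
    (h : HasFGProjectiveResolution (leftTrivial k H) ∨ HasFGProjectiveResolution (rightTrivial k H))
    (n : ℕ) : IsFinitaryExt (leftTrivial k H) n :=
  h.elim (fun h => h.isFinitaryExt n) fun h =>
    (h.isFinitaryExt n).transfer (fun M => (resExt_rightUnit_bijective n M).1)
      (fun M => (resExt_leftUnit_bijective n M).2) (leftAug k H) leftAug_leftEmb

theorem isFinitaryExt_rightTrivial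
    (h : HasFGProjectiveResolution (leftTrivial k H) ∨ HasFGProjectiveResolution (rightTrivial k H))
    (n : ℕ) : IsFinitaryExt (rightTrivial k H) n :=
  h.elim (fun h => (h.isFinitaryExt n).transfer (fun M => (resExt_leftUnit_bijective n M).1)
      (fun M => (resExt_rightUnit_bijective n M).2) (rightAug k H) rightAug_rightEmb)
    fun h => h.isFinitaryExt n

/-- In the coordinate `w` on `Ext` of the regular bimodule with values in `H ⊗ Hᵐᵒᵖ` that a
generator of `Ext^n_H(εk, H)` gives, `c ⊗ op d` acts by `w ↦ d w S²(ξ(c₁) c₂)`. -/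
theorem orbitExt_rightFactor_mul {n : ℕ} {e : LeftExt k H n} {ξ : H →ₐ[k] k}
    (he : IsCharGenerator e ξ) (w c d : H) :
    orbitExt (leftEmb k H) e (rightFactor k H w * (c ⊗ₜ MulOpposite.op d)) =
      orbitExt (leftEmb k H) e
        (rightFactor k H (d * w * antipode k (antipode k (leftWinding ξ c)))) := by
  rw [rightFactor_mul_tmul, map_sum, leftWinding_apply ξ (ℛ k c)]
  simp only [map_sum, Finset.mul_sum, map_smul, mul_smul_comm]
  exact Finset.sum_congr rfl fun i _ => orbitExt_mul _ (he.act _) _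

/-- In the coordinate `w` on `Ext` of the regular bimodule with values in `H ⊗ Hᵐᵒᵖ` that a
generator of `Ext^n_{H^op}(k_ε, H)` gives, `c ⊗ op d` acts by `w ↦ S²(d₁ η(d₂)) w c`. -/
theorem orbitExt_leftFactor_mul {n : ℕ}
    {e : Abelian.Ext.{u} (rightTrivial k H) (ModuleCat.of Hᵐᵒᵖ Hᵐᵒᵖ) n} {η : H →ₐ[k] k}
    (he : IsCharGenerator e fun b => η b.unop) (w c d : H) :
    orbitExt (rightEmb k H) e (leftFactor k H w * (c ⊗ₜ MulOpposite.op d)) =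
      orbitExt (rightEmb k H) e
        (leftFactor k H (antipode k (antipode k (rightWinding η d)) * w * c)) := by
  rw [leftFactor_mul_tmul, map_sum, rightWinding_apply η (ℛ k d)]
  simp only [map_sum, Finset.sum_mul, map_smul, smul_mul_assoc]
  exact Finset.sum_congr rfl fun i _ => orbitExt_mul _ (he.act _) _

/-- By `orbitExt_rightFactor_mul`, such a `c` annihilates `Ext` of the regular bimodule with values
in `H ⊗ Hᵐᵒᵖ`. Computed from right modules, this `Ext` is a sum of copies of `H` on which `c` acts
by right multiplication. -/
theorem eq_zero_of_antipode_sq_leftWinding {n : ℕ} {e : LeftExt k H n} {ξ : H →ₐ[k] k}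
    (he : IsCharGenerator e ξ) (hl : IsFinitaryExt (leftTrivial k H) n)
    (hr : IsFinitaryExt (rightTrivial k H) n) {c : H}
    (hc : antipode k (antipode k (leftWinding ξ c)) = 0) : c = 0 := by
  have h0 (M : ModuleCat.{u} (Envelope k H)) :
    resExt (leftEmb k H) (leftUnit k H) M n 0 = 0 := by simp [resExt]
  by_contra hne
  obtain ⟨z, hz⟩ := (resExt_leftUnit_bijective n _).2 (orbitExt (leftEmb k H) e (rightFactor k H c))
  have hz0 : z ≠ 0 := by
    rintro rfl
    exact hne (eq_zero_of_orbitExt_eq_zero _ leftEmb_rightFactor_bijective he.ne_zero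
      (hz.symm.trans (h0 _)))
  refine hne (hr.eq_zero_of_comp_rightMul_eq_zero (rightEmb k H) rightEmb_leftFactor_bijective
    (resExt_rightUnit_bijective n _) hz0 fun y => ?_)
  apply (resExt_leftUnit_bijective n _).1
  obtain ⟨w, hw⟩ := hl.orbitExt_surjective (leftEmb k H) leftEmb_rightFactor_bijective he.span
    (resExt (leftEmb k H) (leftUnit k H) _ n y)
  rw [resExt_comp_mk₀, ← hw, h0]
  refine (orbitExt_comp_rightMul _ _ _ _).trans ((orbitExt_rightFactor_mul he w c 1).trans ?_)
  rw [hc, mul_zero, map_zero, map_zero]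

theorem eq_zero_of_antipode_sq_rightWinding {n : ℕ}
    {e : Abelian.Ext.{u} (rightTrivial k H) (ModuleCat.of Hᵐᵒᵖ Hᵐᵒᵖ) n} {η : H →ₐ[k] k}
    (he : IsCharGenerator e fun b => η b.unop) (hl : IsFinitaryExt (leftTrivial k H) n)
    (hr : IsFinitaryExt (rightTrivial k H) n) {c : H}
    (hc : antipode k (antipode k (rightWinding η c)) = 0) : c = 0 := by
  have h0 (M : ModuleCat.{u} (Envelope k H)) :
    resExt (rightEmb k H) (rightUnit k H) M n 0 = 0 := by simp [resExt]
  by_contra hne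
  obtain ⟨z, hz⟩ :=
    (resExt_rightUnit_bijective n _).2 (orbitExt (rightEmb k H) e (leftFactor k H c))
  have hz0 : z ≠ 0 := by
    rintro rfl
    exact hne (eq_zero_of_orbitExt_eq_zero _ rightEmb_leftFactor_bijective he.ne_zero
      (hz.symm.trans (h0 _)))
  refine hne (hl.eq_zero_of_comp_rightMul_eq_zero (leftEmb k H) leftEmb_rightFactor_bijective
    (resExt_leftUnit_bijective n _) hz0 fun y => ?_)
  apply (resExt_rightUnit_bijective n _).1
  obtain ⟨w, hw⟩ := hr.orbitExt_surjective (rightEmb k H) rightEmb_leftFactor_bijective he.span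
    (resExt (rightEmb k H) (rightUnit k H) _ n y)
  rw [resExt_comp_mk₀, ← hw, h0]
  refine (orbitExt_comp_rightMul _ _ _ _).trans ((orbitExt_leftFactor_mul he w 1 c).trans ?_)
  rw [hc, zero_mul, zero_mul, map_zero, map_zero]

theorem injective_antipode_of_comp {f : H →ₐ[k] H} (hf : Function.Surjective f)
    (h : ∀ c, antipode k (antipode k (f c)) = 0 → c = 0) :
    Function.Injective (antipode k (A := H)) := by
  rw [injective_iff_map_eq_zero]
  intro a ha
  obtain ⟨c, rfl⟩ := hf a
  rw [h c (by rw [ha, map_zero]), map_zero]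

/-! ### Comparison of the two sides -/

/-- Two parametrizations `Φ`, `Φ'` of sets that are in bijection with a common `Z` differ by a
bijection `θ` of the parameters. -/
theorem exists_bijective_of_span {X Z D D' : Type*} {Φ : X → D} {Φ' : X → D'} {Θ : Z → D}
    {Θ' : Z → D'} (hΦ : Function.Bijective Φ) (hΦ' : Function.Bijective Φ')
    (hΘ : Function.Bijective Θ) (hΘ' : Function.Bijective Θ') :
    ∃ θ : X → X, Function.Bijective θ ∧ ∀ w z, Θ z = Φ w → Θ' z = Φ' (θ w) := by
  let θ := (Equiv.ofBijective Φ hΦ).trans ((Equiv.ofBijective Θ hΘ).symm.trans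
    ((Equiv.ofBijective Θ' hΘ').trans (Equiv.ofBijective Φ' hΦ').symm))
  refine ⟨θ, θ.bijective, fun w z h => ?_⟩
  have h1 : Equiv.ofBijective Θ hΘ z = Equiv.ofBijective Φ hΦ w := h
  have h2 : θ w = (Equiv.ofBijective Φ' hΦ').symm (Equiv.ofBijective Θ' hΘ' z) := by
    simp only [θ, Equiv.trans_apply, ← h1, Equiv.symm_apply_apply]
  exact (Equiv.symm_apply_eq _).1 h2.symm

theorem orbitExt_rightFactor_bijective {n : ℕ} {e : LeftExt k H n} {ξ : H →ₐ[k] k}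
    (he : IsCharGenerator e ξ) (hl : IsFinitaryExt (leftTrivial k H) n) :
    Function.Bijective fun w => orbitExt (leftEmb k H) e (rightFactor k H w) :=
  ⟨orbitExt_injective _ leftEmb_rightFactor_bijective he.ne_zero,
    hl.orbitExt_surjective _ leftEmb_rightFactor_bijective he.span⟩

theorem orbitExt_leftFactor_bijective {n : ℕ}
    {e : Abelian.Ext.{u} (rightTrivial k H) (ModuleCat.of Hᵐᵒᵖ Hᵐᵒᵖ) n} {η : H →ₐ[k] k}
    (he : IsCharGenerator e fun b => η b.unop) (hr : IsFinitaryExt (rightTrivial k H) n) :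
    Function.Bijective fun w => orbitExt (rightEmb k H) e (leftFactor k H w) :=
  ⟨orbitExt_injective _ rightEmb_leftFactor_bijective he.ne_zero,
    hr.orbitExt_surjective _ rightEmb_leftFactor_bijective he.span⟩

/-- The two coordinates on `Ext` of the regular bimodule with values in `H ⊗ Hᵐᵒᵖ` differ by a
bijection `θ`, which intertwines the two descriptions of the action. -/
theorem exists_twisted_bijection {n : ℕ} {e : LeftExt k H n}
    {e' : Abelian.Ext.{u} (rightTrivial k H) (ModuleCat.of Hᵐᵒᵖ Hᵐᵒᵖ) n} {ξ η : H →ₐ[k] k}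
    (he : IsCharGenerator e ξ) (he' : IsCharGenerator e' fun b => η b.unop)
    (hl : IsFinitaryExt (leftTrivial k H) n) (hr : IsFinitaryExt (rightTrivial k H) n) :
    ∃ θ : H → H, Function.Bijective θ ∧ ∀ c d w,
      θ (d * w * antipode k (antipode k (leftWinding ξ c))) =
        antipode k (antipode k (rightWinding η d)) * θ w * c := by
  have hΦ' := orbitExt_leftFactor_bijective he' hr
  obtain ⟨θ, hθ, h⟩ := exists_bijective_of_span (orbitExt_rightFactor_bijective he hl) hΦ'
    (resExt_leftUnit_bijective n (ModuleCat.of (Envelope k H) (Envelope k H)))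
    (resExt_rightUnit_bijective n (ModuleCat.of (Envelope k H) (Envelope k H)))
  refine ⟨θ, hθ, fun c d w => hΦ'.1 ?_⟩
  obtain ⟨z, hz⟩ := (resExt_leftUnit_bijective n _).2
    (orbitExt (leftEmb k H) e (rightFactor k H w))
  have h1 := h _ (z.comp (Abelian.Ext.mk₀ (rightMul (c ⊗ₜ MulOpposite.op d))) (add_zero n))
    ((resExt_comp_mk₀ _ _ _ _).trans (by
      rw [hz]
      exact (orbitExt_comp_rightMul _ _ _ _).trans (orbitExt_rightFactor_mul he w c d)))
  refine h1.symm.trans ((resExt_comp_mk₀ _ _ _ _).trans ?_)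
  rw [h w z hz]
  exact (orbitExt_comp_rightMul _ _ _ _).trans (orbitExt_leftFactor_mul he' _ c d)

/-- A bimodule isomorphism `θ` from the bimodule `R` twisted by `σ` on the right to `R` twisted by
`τ` on the left takes `1` to a unit, if one-sided inverses are well behaved. -/
theorem isUnit_of_twisted_bijection {R : Type*} [Ring R] {σ τ : R →* R} {θ : R → R}
    (hθ : Function.Bijective θ) (h : ∀ c d w, θ (d * w * σ c) = τ d * θ w * c)
    (hreg : (∀ a : R, (∃ b : R, b * a = 1) → IsRegular a) ∨
      (∀ a : R, (∃ b : R, a * b = 1) → IsRegular a)) : IsUnit (θ 1) := by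
  -- `θ` is `d ↦ τ d * θ 1`, so surjectivity makes `θ 1` left invertible.
  obtain ⟨w, hw⟩ := hθ.2 1
  have hu : τ w * θ 1 = 1 := by simpa [hw] using (h 1 w 1).symm
  have hinv (c : R) : θ (w * σ c) = c := by simpa [hw] using h c 1 w
  rcases hreg with hreg | hreg
  · have : θ 1 * τ w = 1 := (hreg _ ⟨_, hu⟩).right (by
      change θ 1 * τ w * θ 1 = 1 * θ 1
      rw [mul_assoc, hu, mul_one, one_mul])
    exact ⟨⟨θ 1, τ w, this, hu⟩, rfl⟩
  -- Injectivity makes `w` right invertible, hence a unit, and `τ w` is a left inverse of `θ 1`.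
  · have hw1 : w * σ (θ 1) = 1 := hθ.1 (hinv _)
    have hw2 : σ (θ 1) * w = 1 := (hreg _ ⟨_, hw1⟩).left (by
      change w * (σ (θ 1) * w) = w * 1
      rw [← mul_assoc, hw1, mul_one, one_mul])
    have hwu : IsUnit w := ⟨⟨w, σ (θ 1), hw1, hw2⟩, rfl⟩
    obtain ⟨v, hv⟩ := hwu.map τ
    rw [← hv, Units.mul_eq_one_iff_inv_eq] at hu
    exact ⟨v⁻¹, hu⟩

variable (k H) in
/-- The algebra endomorphism `S²`. -/
def antipodeSq : H →ₐ[k] H :=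
  AlgHom.ofLinearMap (antipode k (A := H) ∘ₗ antipode k (A := H)) (by simp)
    (by simp [antipode_mul_antidistrib])

end Final

end HopfExt

theorem theorem0p2 {k H : Type u} [Field k] [Ring H] [HopfAlgebra k H]
    (hres : HopfExt.HasFGProjectiveResolution (HopfExt.leftTrivial k H) ∨
      HopfExt.HasFGProjectiveResolution (HopfExt.rightTrivial k H)) :
    (((∃ i : ℕ, Module.finrank k (HopfExt.LeftExt k H i) = 1) ∨
        (∃ j : ℕ, Module.finrank k (HopfExt.RightExt k H j) = 1)) →
      Function.Injective (HopfAlgebra.antipode k : H →ₗ[k] H)) ∧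
    (∀ i : ℕ, Module.finrank k (HopfExt.LeftExt k H i) = 1 →
      Module.finrank k (HopfExt.RightExt k H i) = 1 →
      ((∀ a : H, (∃ b : H, b * a = 1) → IsRegular a) ∨
        (∀ a : H, (∃ b : H, a * b = 1) → IsRegular a)) →
      Function.Bijective (HopfAlgebra.antipode k : H →ₗ[k] H) ∧
      ∃ ξ η : H →ₐ[k] k,
        (∀ (x : HopfExt.LeftExt k H i) (b : H), HopfExt.rightAct x b = ξ b • x) ∧
        (∀ (b : H) (x : HopfExt.RightExt k H i), HopfExt.leftAct b x = η b • x) ∧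
        ∃ v : Hˣ, ∀ a : H,
          (HopfAlgebra.antipode k : H →ₗ[k] H)^[4]
            (HopfExt.leftWinding ξ (HopfExt.rightWinding η a)) = ↑v⁻¹ * a * ↑v) := by
  have hl := HopfExt.isFinitaryExt_leftTrivial hres
  have hr := HopfExt.isFinitaryExt_rightTrivial hres
  have hinj : ((∃ i : ℕ, Module.finrank k (HopfExt.LeftExt k H i) = 1) ∨
        (∃ j : ℕ, Module.finrank k (HopfExt.RightExt k H j) = 1)) →
      Function.Injective (HopfAlgebra.antipode k : H →ₗ[k] H) := by
    rintro (⟨i, hi⟩ | ⟨i, hi⟩)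
    · obtain ⟨ξ, hξ⟩ := HopfExt.exists_char_rightAct hi
      obtain ⟨e, he⟩ := HopfExt.exists_isCharGenerator_left hi ξ hξ
      exact HopfExt.injective_antipode_of_comp (HopfExt.leftWinding_surjective ξ) fun c =>
        HopfExt.eq_zero_of_antipode_sq_leftWinding he (hl i) (hr i)
    · obtain ⟨η, hη⟩ := HopfExt.exists_char_leftAct hi
      obtain ⟨e, he⟩ := HopfExt.exists_isCharGenerator_right hi η hη
      exact HopfExt.injective_antipode_of_comp (HopfExt.rightWinding_surjective η) fun c =>
        HopfExt.eq_zero_of_antipode_sq_rightWinding he (hl i) (hr i)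
  refine ⟨hinj, fun i hi hi' hreg => ?_⟩
  obtain ⟨ξ, hξ⟩ := HopfExt.exists_char_rightAct hi
  obtain ⟨e, he⟩ := HopfExt.exists_isCharGenerator_left hi ξ hξ
  obtain ⟨η, hη⟩ := HopfExt.exists_char_leftAct hi'
  obtain ⟨e', he'⟩ := HopfExt.exists_isCharGenerator_right hi' η hη
  obtain ⟨θ, hθ, hmul⟩ := HopfExt.exists_twisted_bijection he he' (hl i) (hr i)
  obtain ⟨u, hu⟩ := HopfExt.isUnit_of_twisted_bijection
    (σ := ((HopfExt.antipodeSq k H).comp (HopfExt.leftWinding ξ) : H →ₐ[k] H))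
    (τ := ((HopfExt.antipodeSq k H).comp (HopfExt.rightWinding η) : H →ₐ[k] H)) hθ hmul hreg
  have hτ (d : H) : θ d = HopfAlgebra.antipode k
      (HopfAlgebra.antipode k (HopfExt.rightWinding η d)) * u := by
    simpa [hu] using hmul 1 d 1
  have hσ (c : H) : θ (HopfAlgebra.antipode k
      (HopfAlgebra.antipode k (HopfExt.leftWinding ξ c))) = u * c := by
    simpa [hu] using hmul c 1 1
  -- `u * a = θ (S² (Ξˡ a)) = S² (Ξʳ (S² (Ξˡ a))) * u`, so `v = u⁻¹` does it.
  refine ⟨⟨hinj (Or.inl ⟨i, hi⟩), fun b => ?_⟩, ξ, η, hξ, hη, u⁻¹, fun a => ?_⟩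
  · obtain ⟨d, hd⟩ := hθ.2 (b * u)
    exact ⟨_, u.isUnit.mul_right_cancel ((hτ d).symm.trans hd)⟩
  · rw [inv_inv, Units.eq_mul_inv_iff_mul_eq, ← hσ, hτ, HopfExt.rightWinding_antipode_sq,
      HopfExt.leftWinding_rightWinding_comm]
    rfl
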